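/- Let $d\ge 0$ be an integer and let $\beta>0$ satisfy $\beta<\beta_c(d)$, where for $d\ge 3$ the number $\beta_c(d)$ is defined by $(d-1)\tanh\beta_c(d)=1$, and $\beta_c(d)=\infty$ for $d\le 2$. Then there is a constant $C=C(d,\beta)>0$ such that the following holds for every finite nonempty simple graph $G=(V,E)$ with $n=|V|$ vertices and all degrees at most $d$, and for every finite family of blocks $B_1,\dots,B_r\subseteq V$ with $V=\bigcup_{i=1}^r B_i$ (there is no other restriction on the blocks). Let $\mu$ be the ferromagnetic Ising distribution on $\{+1,-1\}^V$, $$\mu(\sigma)=\frac1Z\exp\Big[\beta\sum_{\{u,v\}\in E}\sigma(u)\sigma(v)\Big],$$ where $Z$ is the normalizing constant, and let $P$ be the transition matrix of the heat-bath block dynamics, which in each step picks $k\in\{1,\dots,r\}$ uniformly at random and replaces the configuration on $B_k$ by a sample from $\mu$ conditioned on the current configuration on $V\setminus B_k$. Then: 1. if $n\ge 2$, the mixing time $T_{\mathrm{mix}}(P)=\max_{X_0}\min\{t\ge 0:\ \|P^t(X_0,\cdot)-\mu\|_{\mathrm{TV}}\le 1/4\}$ satisfies $T_{\mathrm{mix}}(P)\le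 C\,r\log n$; 2. the relaxation time $T_{\mathrm{rel}}(P)=(1-\lambda^*)^{-1}$ satisfies $T_{\mathrm{rel}}(P)\le C\,r$, where $\lambda^*=\max\{|\lambda_2|,|\lambda_N|\}$ and $1=\lambda_1>\lambda_2\ge\dots\ge\lambda_N\ge -1$, with $N=2^n$, are the eigenvalues of $P$. -/

import Mathlib

open scoped ENNReal

namespace IsingBlocks

noncomputable section

/-! ## Finite Markov chains -/

section Chains

variable {Ω : Type*} [Fintype Ω]

/-- Total variation distance between two mass functions on a finite set. -/
def tvDist (p q : Ω → ℝ) : ℝ := (1 / 2) * ∑ x, |p x - q x|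

/-- The mixing time of the transition matrix `P` with target distribution `π` and accuracy `ε`:
the maximum over the starting states `x` of the least `t ≥ 0` such that
`‖P ^ t (x, ·) - π‖_TV ≤ ε`. It is `⊤` if, from some `x`, there is no such `t`. -/
def mixingTime [DecidableEq Ω] (P : Matrix Ω Ω ℝ) (π : Ω → ℝ) (ε : ℝ) : ℕ∞ :=
  ⨆ x : Ω, ⨅ t : ℕ, ⨅ _ : tvDist ((P ^ t) x) π ≤ ε, (t : ℕ∞)

/-- The eigenvalues `λ₂, …, λ_N` of a stochastic matrix `P` that is reversible with respect to a
positive distribution, as a set: all the eigenvalues other than the eigenvalue `λ₁ = 1` of the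
constant functions. An eigenfunction for an eigenvalue `≠ 1` is never constant, and a nonconstant
eigenfunction for the eigenvalue `1` exists exactly if `1` is a multiple eigenvalue, so that in this
case (a reducible chain) the value `1` is kept. -/
def nontrivialEigenvalues (P : Matrix Ω Ω ℝ) : Set ℝ :=
  {l | ∃ f : Ω → ℝ, (∃ x y, f x ≠ f y) ∧ P.mulVec f = l • f}

/-- `λ* = max {|λ₂|, |λ_N|}`, the largest modulus of a nontrivial eigenvalue. -/
def lambdaStar (P : Matrix Ω Ω ℝ) : ℝ≥0∞ :=
  ⨆ l ∈ nontrivialEigenvalues P, ENNReal.ofReal |l|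

/-- The relaxation time `(1 - λ*)⁻¹`, the inverse of the absolute spectral gap of a reversible
chain. It is `⊤` if the gap vanishes. -/
def relaxationTime (P : Matrix Ω Ω ℝ) : ℝ≥0∞ := (1 - lambdaStar P)⁻¹

end Chains

/-! ## The ferromagnetic Ising model -/

/-- The critical inverse temperature for degree `d`, that is the solution of
`(d - 1) * tanh β = 1` if `3 ≤ d`. For `d ≤ 2` there is no solution, `(d - 1) * tanh β < 1` holds
for every `β`, and the critical value is `⊤`. -/
def betaC (d : ℕ) : EReal :=
  if 3 ≤ d then ((Real.artanh (1 / ((d : ℝ) - 1)) : ℝ) : EReal) else ⊤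

theorem betaC_spec {d : ℕ} (hd : 3 ≤ d) :
    ∃ b : ℝ, betaC d = (b : EReal) ∧ ((d : ℝ) - 1) * Real.tanh b = 1 := by
  have h3 : (3 : ℝ) ≤ d := by exact_mod_cast hd
  refine ⟨Real.artanh (1 / ((d : ℝ) - 1)), by simp [betaC, hd], ?_⟩
  have h2 : (0 : ℝ) < (d : ℝ) - 1 := by linarith
  have h0 : 0 < 1 / ((d : ℝ) - 1) := by positivity
  have h1 : 1 / ((d : ℝ) - 1) < 1 := by rw [div_lt_one h2]; linarith
  rw [Real.tanh_artanh ⟨by linarith, h1⟩]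
  field_simp

section Ising

variable {V : Type*} [Fintype V] [DecidableEq V]

/-- The numerical value of a spin: `true` is `+`, `false` is `-`. -/
def spin (b : Bool) : ℝ := if b then 1 else -1

/-- The weight `exp (β * ∑_{uv ∈ E} σ(u) σ(v))` of the configuration `σ : V → Bool`. -/
def isingWeight (G : SimpleGraph V) [DecidableRel G.Adj] (β : ℝ) (σ : V → Bool) : ℝ :=
  Real.exp (β * ∑ e ∈ G.edgeFinset, (e.map fun v => spin (σ v)).mul)

/-- The Gibbs distribution of the Ising model on `G` at inverse temperature `β`. -/
def gibbs (G : SimpleGraph V) [DecidableRel G.Adj] (β : ℝ) (σ : V → Bool) : ℝ :=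
  isingWeight G β σ / ∑ η : V → Bool, isingWeight G β η

/-- Two configurations agree outside the block `B`. -/
def AgreeOff (B : Finset V) (σ τ : V → Bool) : Prop := ∀ v, v ∉ B → τ v = σ v

instance (B : Finset V) (σ τ : V → Bool) : Decidable (AgreeOff B σ τ) := by
  unfold AgreeOff; infer_instance

/-- The heat-bath update of the block `B`: from `σ`, the new configuration `τ` is drawn from the
Gibbs distribution conditioned on agreeing with `σ` on `V \ B`. -/
def heatBath (G : SimpleGraph V) [DecidableRel G.Adj] (β : ℝ) (B : Finset V) :
    Matrix (V → Bool) (V → Bool) ℝ :=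
  Matrix.of fun σ τ =>
    if AgreeOff B σ τ then
      gibbs G β τ / ∑ η : V → Bool with AgreeOff B σ η, gibbs G β η
    else 0

/-- The transition matrix of the heat-bath block dynamics: in each step one of the `r` blocks is
picked uniformly at random and updated by `heatBath`. -/
def blockDynamics (G : SimpleGraph V) [DecidableRel G.Adj] (β : ℝ) {r : ℕ}
    (B : Fin r → Finset V) : Matrix (V → Bool) (V → Bool) ℝ :=
  (r : ℝ)⁻¹ • ∑ i, heatBath G β (B i)

end Ising

end

end IsingBlocks

set_option linter.unusedSectionVars false

namespace IsingBlocks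

noncomputable section

/-! ### The Ising weight: lattice condition and single spin flips -/

section IsingWeight

variable {V : Type*} [Fintype V] [DecidableEq V]

/-! The proof compares the block dynamics, on increasing functions, with updates of single spins.
The heat-bath update of `A` is the orthogonal projection E_A in L²(μ) onto the functions that ignore
the spins in `A`. By the Holley and FKG inequalities E_A preserves increasing functions, and ⟨E_A f,
g⟩ ≤ ⟨E_B f, g⟩ for increasing f, g and B ⊆ A. This order survives products (`ComparisonLE.mul`), so
r steps of the block dynamics do at least as well as updating any prescribed spin with probability
1/2, and a multiple of r steps does at least as well as repeated sweeps over a ball. As the point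
mass at ⊤ and minus the point mass at ⊥ are increasing, this controls the gap between the
expectations started from ⊤ and from ⊥ (`extremalGap_add_le_sweep`).

Sweeps over a ball of fixed radius approach the heat-bath update of the ball at a rate independent
of n. That update nearly forgets the boundary at the centre. Indeed, deleting a vertex expresses its
half log odds as its own field plus half a sum, over its neighbours, of log cosh (x + 2β) - log cosh
x, up to constants, where x is a half log odds at the neighbour. This function is 2 tanh
β-Lipschitz, and each neighbour has at most q = d - 1 neighbours left. Influence is thus multiplied
by at most q tanh β < 1 per step away from the vertex (`exists_influence`). Consequently the largest
gap of a single spin halves every N r steps (`exists_extremalGap_le_half`).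

A function with bounded dependence on each spin is dominated by a linear combination of spins, so
its oscillation after N r j steps is of order n / 2 ^ j. Sign functions turn this into total
variation; for an eigenfunction the factor n disappears as j → ∞. -/

theorem isingWeight_pos (G : SimpleGraph V) [DecidableRel G.Adj] (β : ℝ) (σ : V → Bool) :
    0 < isingWeight G β σ := Real.exp_pos _

theorem spin_mul_add_spin_mul_le (a b c d : Bool) :
    spin a * spin b + spin c * spin d ≤
      spin (a ⊓ c) * spin (b ⊓ d) + spin (a ⊔ c) * spin (b ⊔ d) := by
  cases a <;> cases b <;> cases c <;> cases d <;> norm_num [spin]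

/-- The interaction is a sum over edges, so the lattice condition reduces to a check on the four
spins of one edge. -/
theorem isingWeight_mul_le (G : SimpleGraph V) [DecidableRel G.Adj] {β : ℝ} (hβ : 0 ≤ β)
    (σ τ : V → Bool) :
    isingWeight G β σ * isingWeight G β τ ≤
      isingWeight G β (σ ⊓ τ) * isingWeight G β (σ ⊔ τ) := by
  unfold isingWeight
  rw [← Real.exp_add, ← Real.exp_add, Real.exp_le_exp, ← mul_add, ← mul_add,
    ← Finset.sum_add_distrib, ← Finset.sum_add_distrib]
  refine mul_le_mul_of_nonneg_left (Finset.sum_le_sum fun e _ => ?_) hβ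
  induction e with
  | _ x y =>
    simpa using spin_mul_add_spin_mul_le (σ x) (σ y) (τ x) (τ y)

theorem sum_edgeFinset_filter_mem (G : SimpleGraph V) [DecidableRel G.Adj] (u : V)
    (f : Sym2 V → ℝ) :
    ∑ e ∈ G.edgeFinset with u ∈ e, f e = ∑ w ∈ G.neighborFinset u, f s(u, w) := by
  symm
  refine Finset.sum_nbij (fun w => s(u, w)) ?_ ?_ ?_ ?_
  · intro w hw
    simpa using hw
  · intro w _ w' _ h
    exact Sym2.congr_right.1 h
  · intro e he
    obtain ⟨h1, w, rfl⟩ : e ∈ G.edgeSet ∧ u ∈ e := by simpa using he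
    exact ⟨w, by simpa using h1, rfl⟩
  · intros; rfl

theorem isingWeight_update_true (G : SimpleGraph V) [DecidableRel G.Adj] (β : ℝ)
    (σ : V → Bool) (u : V) :
    isingWeight G β (Function.update σ u true) =
      isingWeight G β (Function.update σ u false) *
        Real.exp (2 * β * ∑ w ∈ G.neighborFinset u, spin (σ w)) := by
  unfold isingWeight
  rw [← Real.exp_add]
  congr 1
  rw [mul_comm 2 β, mul_assoc, ← mul_add]
  congr 1
  rw [← Finset.sum_filter_add_sum_filter_not _ (fun e => u ∈ e),
    ← Finset.sum_filter_add_sum_filter_not G.edgeFinset (fun e => u ∈ e)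
      (fun e => (e.map fun v => spin (Function.update σ u false v)).mul),
    sum_edgeFinset_filter_mem, sum_edgeFinset_filter_mem]
  have h1 : ∑ e ∈ G.edgeFinset with ¬ u ∈ e,
        (e.map fun v => spin (Function.update σ u true v)).mul =
      ∑ e ∈ G.edgeFinset with ¬ u ∈ e,
        (e.map fun v => spin (Function.update σ u false v)).mul := by
    refine Finset.sum_congr rfl fun e he => ?_
    have he' : u ∉ e := (Finset.mem_filter.1 he).2
    induction e with
    | _ x y =>
      have hx : x ≠ u := by rintro rfl; simp at he'
      have hy : y ≠ u := by rintro rfl; simp at he'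
      simp [hx, hy]
  have h2 : ∀ b, ∑ w ∈ G.neighborFinset u,
        ((s(u, w)).map fun v => spin (Function.update σ u b v)).mul =
      spin b * ∑ w ∈ G.neighborFinset u, spin (σ w) := by
    intro b
    rw [Finset.mul_sum]
    refine Finset.sum_congr rfl fun w hw => ?_
    have hw' : w ≠ u := by
      rintro rfl
      simp at hw
    simp [hw']
  rw [h1, h2, h2]
  simp only [spin, if_true, Bool.false_eq_true, if_false]
  ring

theorem abs_spin (b : Bool) : |spin b| = 1 := by cases b <;> simp [spin]

theorem sum_neighborFinset_spin_abs_le (G : SimpleGraph V) [DecidableRel G.Adj] (σ : V → Bool)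
    (u : V) : |∑ w ∈ G.neighborFinset u, spin (σ w)| ≤ G.degree u := by
  refine (Finset.abs_sum_le_sum_abs _ _).trans ?_
  simp [abs_spin]

end IsingWeight

/-! ### Partition sums with a boundary condition -/

section Fiber

variable {V : Type*} [Fintype V] [DecidableEq V]

theorem AgreeOff.update_update {A : Finset V} {σ τ : V → Bool} (u : V) (b : Bool)
    (h : AgreeOff A σ τ) : AgreeOff A (Function.update σ u b) (Function.update τ u b) := by
  intro v hv
  by_cases hvu : v = u
  · subst hvu; simp
  · simp [hvu, h v hv]

theorem AgreeOff.refl (A : Finset V) (σ : V → Bool) : AgreeOff A σ σ := fun _ _ => rfl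

theorem AgreeOff.symm {A : Finset V} {σ τ : V → Bool} (h : AgreeOff A σ τ) : AgreeOff A τ σ :=
  fun v hv => (h v hv).symm

theorem AgreeOff.trans {A : Finset V} {σ τ η : V → Bool} (h : AgreeOff A σ τ)
    (h' : AgreeOff A τ η) : AgreeOff A σ η := fun v hv => (h' v hv).trans (h v hv)

theorem AgreeOff.mono {A B : Finset V} {σ τ : V → Bool} (hAB : A ⊆ B) (h : AgreeOff A σ τ) :
    AgreeOff B σ τ := fun v hv => h v fun hA => hv (hAB hA)

theorem agreeOff_update {A : Finset V} {u : V} (hu : u ∈ A) (σ : V → Bool) (b : Bool) :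
    AgreeOff A σ (Function.update σ u b) := by
  intro v hv
  have : v ≠ u := by rintro rfl; exact hv hu
  simp [this]

/-- The unnormalized integral of `f` over the configurations that agree with `σ` off `A`. -/
def fiberSum (G : SimpleGraph V) [DecidableRel G.Adj] (β : ℝ) (A : Finset V) (σ : V → Bool)
    (f : (V → Bool) → ℝ) : ℝ :=
  ∑ τ with AgreeOff A σ τ, isingWeight G β τ * f τ

variable (G : SimpleGraph V) [DecidableRel G.Adj] (β : ℝ)

theorem fiberSum_pos (A : Finset V) (σ : V → Bool) {f : (V → Bool) → ℝ} (hf : ∀ τ, 0 < f τ) :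
    0 < fiberSum G β A σ f :=
  Finset.sum_pos (fun τ _ => mul_pos (isingWeight_pos G β τ) (hf τ))
    ⟨σ, by simp [AgreeOff.refl]⟩

theorem fiberSum_one_pos (A : Finset V) (σ : V → Bool) : 0 < fiberSum G β A σ 1 :=
  fiberSum_pos G β A σ fun _ => zero_lt_one

theorem fiberSum_congr {A : Finset V} {σ τ : V → Bool} (h : AgreeOff A σ τ)
    (f : (V → Bool) → ℝ) : fiberSum G β A σ f = fiberSum G β A τ f := by
  unfold fiberSum
  congr 1
  ext η
  simp only [Finset.mem_filter, Finset.mem_univ, true_and]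
  exact ⟨fun h' => h.symm.trans h', fun h' => h.trans h'⟩

theorem fiberSum_eq_add {A : Finset V} {v : V} (hv : v ∈ A) (σ : V → Bool)
    (f : (V → Bool) → ℝ) :
    fiberSum G β A σ f = fiberSum G β (A.erase v) (Function.update σ v true) f +
      fiberSum G β (A.erase v) (Function.update σ v false) f := by
  have key : ∀ b, ∀ τ, AgreeOff (A.erase v) (Function.update σ v b) τ ↔
      AgreeOff A σ τ ∧ τ v = b := by
    intro b τ
    constructor
    · intro h
      refine ⟨fun w hw => ?_, by simpa using h v (by simp)⟩
      have hwv : w ≠ v := by rintro rfl; exact hw hv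
      simpa [hwv] using h w (fun h' => hw (Finset.mem_of_mem_erase h'))
    · rintro ⟨h, hb⟩ w hw
      by_cases hwv : w = v
      · subst hwv; simp [hb]
      · simpa [hwv] using h w (fun h' => hw (Finset.mem_erase.2 ⟨hwv, h'⟩))
  unfold fiberSum
  simp only [key]
  rw [← Finset.filter_filter, ← Finset.filter_filter,
    ← Finset.sum_filter_add_sum_filter_not _ (fun τ : V → Bool => τ v = true)]
  simp

/-- Flipping `u` is a bijection between the two fibers that changes the weight only through the
edges at `u`. A frozen spin is thereby traded for a field on its neighbours. -/
theorem fiberSum_update_true {A : Finset V} {u : V} (hu : u ∉ A) (σ : V → Bool)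
    (f : (V → Bool) → ℝ) :
    fiberSum G β A (Function.update σ u true) f =
      fiberSum G β A (Function.update σ u false) fun τ =>
        Real.exp (2 * β * ∑ w ∈ G.neighborFinset u, spin (τ w)) *
          f (Function.update τ u true) := by
  unfold fiberSum
  refine Finset.sum_nbij' (fun τ => Function.update τ u false)
    (fun τ => Function.update τ u true) ?_ ?_ ?_ ?_ ?_
  · intro τ hτ
    have := (Finset.mem_filter.1 hτ).2.update_update u false
    simpa using this
  · intro τ hτ
    have := (Finset.mem_filter.1 hτ).2.update_update u true
    simpa using this
  · intro τ hτ
    have : τ u = true := by simpa using (Finset.mem_filter.1 hτ).2 u hu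
    simp [← this]
  · intro τ hτ
    have : τ u = false := by simpa using (Finset.mem_filter.1 hτ).2 u hu
    simp [← this]
  · intro τ hτ
    have h1 : τ u = true := by simpa using (Finset.mem_filter.1 hτ).2 u hu
    have h2 : Function.update τ u true = τ := by simp [← h1]
    have h3 : ∑ w ∈ G.neighborFinset u, spin (Function.update τ u false w) =
        ∑ w ∈ G.neighborFinset u, spin (τ w) := by
      refine Finset.sum_congr rfl fun w hw => ?_
      have hw' : w ≠ u := by
        rintro rfl
        simp at hw
      simp [hw']
    beta_reduce
    rw [h3, Function.update_idem, h2, ← mul_assoc, ← isingWeight_update_true, h2]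

end Fiber

/-! ### Hyperbolic functions and the Lipschitz constant 2 tanh β -/

section RealAnalysis

/-- The derivative is tanh (x + 2β) - tanh x, the increment of tanh over an interval of length 2β,
which is largest when the interval is centred at 0. -/
theorem abs_log_cosh_sub_le {β : ℝ} (hβ : 0 ≤ β) (x y : ℝ) :
    |(Real.log (Real.cosh (x + 2 * β)) - Real.log (Real.cosh x)) -
      (Real.log (Real.cosh (y + 2 * β)) - Real.log (Real.cosh y))| ≤
      2 * Real.tanh β * |x - y| := by
  have hder : ∀ z : ℝ, HasDerivAt
      (fun z => Real.log (Real.cosh (z + 2 * β)) - Real.log (Real.cosh z))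
      (Real.sinh (z + 2 * β) / Real.cosh (z + 2 * β) - Real.sinh z / Real.cosh z) z := by
    intro z
    have h1 : HasDerivAt (fun z : ℝ => z + 2 * β) 1 z := (hasDerivAt_id z).add_const _
    have h2 := (h1.cosh).log (Real.cosh_pos _).ne'
    have h3 := (Real.hasDerivAt_cosh z).log (Real.cosh_pos _).ne'
    simpa using h2.fun_sub h3
  have hb : ∀ z : ℝ,
      ‖Real.sinh (z + 2 * β) / Real.cosh (z + 2 * β) - Real.sinh z / Real.cosh z‖ ≤
        2 * Real.tanh β := by
    intro z
    -- With midpoint w the derivative equals 2 sinh β cosh β / (cosh² β + sinh² w).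
    obtain ⟨w, rfl⟩ : ∃ w, z = w - β := ⟨z + β, by ring⟩
    have e1 : w - β + 2 * β = w + β := by ring
    rw [e1, Real.norm_eq_abs, div_sub_div _ _ (Real.cosh_pos _).ne' (Real.cosh_pos _).ne',
      Real.tanh_eq_sinh_div_cosh]
    have hc := Real.cosh_sq β
    have hw := Real.cosh_sq w
    have hs : 0 ≤ Real.sinh β := Real.sinh_nonneg_iff.2 hβ
    have hcp := Real.cosh_pos β
    have num : Real.sinh (w + β) * Real.cosh (w - β) - Real.cosh (w + β) * Real.sinh (w - β) =
        2 * Real.sinh β * Real.cosh β := by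
      rw [Real.sinh_add, Real.cosh_sub, Real.cosh_add, Real.sinh_sub]
      linear_combination (2 * Real.sinh β * Real.cosh β) * hw
    have den : Real.cosh (w + β) * Real.cosh (w - β) = Real.cosh β ^ 2 + Real.sinh w ^ 2 := by
      rw [Real.cosh_sub, Real.cosh_add]
      linear_combination (Real.cosh β ^ 2) * hw - Real.sinh w ^ 2 * (-hc)
    rw [num, den, abs_of_nonneg (by positivity), mul_div_assoc', div_le_div_iff₀ (by positivity) hcp]
    nlinarith [mul_nonneg hs (sq_nonneg (Real.sinh w))]
  have := Convex.norm_image_sub_le_of_norm_hasDerivWithin_le (s := Set.univ)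
    (fun z _ => (hder z).hasDerivWithinAt) (fun z _ => hb z) convex_univ
    (Set.mem_univ y) (Set.mem_univ x)
  simpa [Real.norm_eq_abs] using this

theorem abs_tanh_sub_le (x y : ℝ) : |Real.tanh x - Real.tanh y| ≤ |x - y| := by
  have hder : ∀ z : ℝ, HasDerivAt Real.tanh (1 / Real.cosh z ^ 2) z := by
    intro z
    have h := (Real.hasDerivAt_sinh z).div (Real.hasDerivAt_cosh z) (Real.cosh_pos z).ne'
    have e : Real.tanh = Real.sinh / Real.cosh := by
      ext t; simp [Real.tanh_eq_sinh_div_cosh]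
    rw [e]
    refine h.congr_deriv ?_
    congr 1
    linear_combination Real.cosh_sq z
  have := Convex.norm_image_sub_le_of_norm_hasDerivWithin_le (s := Set.univ) (C := 1)
    (fun z _ => (hder z).hasDerivWithinAt) (fun z _ => ?_) convex_univ
    (Set.mem_univ y) (Set.mem_univ x)
  · simpa [Real.norm_eq_abs] using this
  · rw [Real.norm_eq_abs, abs_of_nonneg (by positivity), div_le_one (by positivity)]
    nlinarith [Real.one_le_cosh z]

theorem exp_add_exp_eq (a b c : ℝ) :
    Real.exp (c + a) + Real.exp (-c + b) =
      2 * Real.exp ((a + b) / 2) * Real.cosh ((a - b) / 2 + c) := by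
  rw [Real.cosh_eq]
  have h1 : Real.exp (c + a) = Real.exp ((a + b) / 2) * Real.exp ((a - b) / 2 + c) := by
    rw [← Real.exp_add]; congr 1; ring
  have h2 : Real.exp (-c + b) = Real.exp ((a + b) / 2) * Real.exp (-((a - b) / 2 + c)) := by
    rw [← Real.exp_add]; congr 1; ring
  rw [h1, h2]; ring

theorem tanh_half_log_sub {x y : ℝ} (hx : 0 < x) (hy : 0 < y) :
    Real.tanh ((Real.log x - Real.log y) / 2) = (x - y) / (x + y) := by
  set a := Real.log x
  set b := Real.log y
  have ha : x = Real.exp a := (Real.exp_log hx).symm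
  have hb : y = Real.exp b := (Real.exp_log hy).symm
  have h1 : Real.exp a = Real.exp ((a + b) / 2) * Real.exp ((a - b) / 2) := by
    rw [← Real.exp_add]; congr 1; ring
  have h2 : Real.exp b = Real.exp ((a + b) / 2) * Real.exp (-((a - b) / 2)) := by
    rw [← Real.exp_add]; congr 1; ring
  rw [ha, hb, h1, h2, Real.tanh_eq_sinh_div_cosh, Real.sinh_eq, Real.cosh_eq, ← mul_sub,
    ← mul_add, mul_div_mul_left _ _ (Real.exp_pos _).ne', div_div_div_cancel_right₀ two_ne_zero]

end RealAnalysis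

/-! ### External fields and half log odds -/

section Field

variable {V : Type*} [Fintype V] [DecidableEq V]
variable (G : SimpleGraph V) [DecidableRel G.Adj] (β : ℝ)

/-- The partition function over the configurations that agree with `σ` off `A`, with the external
field `h`. -/
def fieldZ (A : Finset V) (σ : V → Bool) (h : V → ℝ) : ℝ :=
  fiberSum G β A σ fun τ => Real.exp (∑ x, h x * spin (τ x))

/-- Half the logarithm of the odds of the spin at `v`, for the Ising model on `A` with boundary
condition `σ` and external field `h`. -/
def halfLogOdds (A : Finset V) (v : V) (σ : V → Bool) (h : V → ℝ) : ℝ :=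
  (Real.log (fieldZ G β (A.erase v) (Function.update σ v true) h) -
    Real.log (fieldZ G β (A.erase v) (Function.update σ v false) h)) / 2

theorem fieldZ_pos (A : Finset V) (σ : V → Bool) (h : V → ℝ) : 0 < fieldZ G β A σ h :=
  fiberSum_pos G β A σ fun _ => Real.exp_pos _

theorem sum_single_add_mul_spin (h : V → ℝ) (w : V) (c : ℝ) (τ : V → Bool) :
    ∑ x, (h + (Pi.single w c : V → ℝ)) x * spin (τ x) = c * spin (τ w) + ∑ x, h x * spin (τ x) := by
  simp [add_mul, Finset.sum_add_distrib, Pi.single_apply, add_comm]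

theorem fieldZ_add_single_of_notMem {A : Finset V} {w : V} (hw : w ∉ A) (σ : V → Bool)
    (h : V → ℝ) (c : ℝ) :
    fieldZ G β A σ (h + Pi.single w c) = Real.exp (c * spin (σ w)) * fieldZ G β A σ h := by
  unfold fieldZ fiberSum
  rw [Finset.mul_sum]
  refine Finset.sum_congr rfl fun τ hτ => ?_
  have : τ w = σ w := (Finset.mem_filter.1 hτ).2 w hw
  beta_reduce
  rw [sum_single_add_mul_spin, Real.exp_add, this]
  ring

/-- Splitting by the spin at `w`, Z = e^c Z₊ + e^(-c) Z₋ = 2 √(Z₊ Z₋) cosh (H + c) with H the half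
log odds; the prefactor does not depend on c and cancels. -/
theorem log_fieldZ_add_single_of_mem {A : Finset V} {w : V} (hw : w ∈ A) (σ : V → Bool)
    (h : V → ℝ) (c : ℝ) :
    Real.log (fieldZ G β A σ (h + Pi.single w c)) - Real.log (fieldZ G β A σ h) =
      Real.log (Real.cosh (halfLogOdds G β A w σ h + c)) -
        Real.log (Real.cosh (halfLogOdds G β A w σ h)) := by
  have hsplit : ∀ c : ℝ, Real.log (fieldZ G β A σ (h + Pi.single w c)) = Real.log 2 +
      (Real.log (fieldZ G β (A.erase w) (Function.update σ w true) h) +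
        Real.log (fieldZ G β (A.erase w) (Function.update σ w false) h)) / 2 +
      Real.log (Real.cosh (halfLogOdds G β A w σ h + c)) := by
    intro c
    have h1 : fieldZ G β A σ (h + Pi.single w c) =
        Real.exp c * fieldZ G β (A.erase w) (Function.update σ w true) h +
        Real.exp (-c) * fieldZ G β (A.erase w) (Function.update σ w false) h := by
      conv_lhs => rw [fieldZ, fiberSum_eq_add G β hw]
      have h2 := fieldZ_add_single_of_notMem G β (Finset.notMem_erase w A)
        (Function.update σ w true) h c
      have h3 := fieldZ_add_single_of_notMem G β (Finset.notMem_erase w A)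
        (Function.update σ w false) h c
      simp only [fieldZ] at h2 h3 ⊢
      rw [h2, h3]
      simp [spin]
    have hp := fieldZ_pos G β (A.erase w) (Function.update σ w true) h
    have hm := fieldZ_pos G β (A.erase w) (Function.update σ w false) h
    rw [h1]
    nth_rewrite 1 [← Real.exp_log hp, ← Real.exp_log hm]
    rw [← Real.exp_add, ← Real.exp_add, exp_add_exp_eq, Real.log_mul (by positivity)
      (Real.cosh_pos _).ne', Real.log_mul (by positivity) (by positivity), Real.log_exp]
    rfl
  have h0 := hsplit 0
  rw [Pi.single_zero, add_zero, add_zero] at h0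
  rw [hsplit c, h0]
  ring

theorem fieldZ_update_true {A : Finset V} {u : V} (hu : u ∉ A) (σ : V → Bool) (h : V → ℝ) :
    fieldZ G β A (Function.update σ u true) h = Real.exp (2 * h u) *
      fieldZ G β A (Function.update σ u false)
        (h + ∑ w ∈ G.neighborFinset u, Pi.single w (2 * β)) := by
  unfold fieldZ
  rw [fiberSum_update_true G β hu]
  unfold fiberSum
  rw [Finset.mul_sum]
  refine Finset.sum_congr rfl fun τ hτ => ?_
  have hτu : τ u = false := by simpa using (Finset.mem_filter.1 hτ).2 u hu
  have h1 : ∑ x, h x * spin (Function.update τ u true x) =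
      2 * h u + ∑ x, h x * spin (τ x) := by
    rw [← Finset.add_sum_erase _ _ (Finset.mem_univ u),
      ← Finset.add_sum_erase Finset.univ (fun x => h x * spin (τ x)) (Finset.mem_univ u)]
    have : ∑ x ∈ Finset.univ.erase u, h x * spin (Function.update τ u true x) =
        ∑ x ∈ Finset.univ.erase u, h x * spin (τ x) :=
      Finset.sum_congr rfl fun x hx => by
        rw [Function.update_of_ne (Finset.ne_of_mem_erase hx)]
    rw [this, hτu]
    simp [spin]
    ring
  have h2 : ∑ x, (h + ∑ w ∈ G.neighborFinset u, Pi.single w (2 * β)) x * spin (τ x) =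
      ∑ x, h x * spin (τ x) + 2 * β * ∑ w ∈ G.neighborFinset u, spin (τ w) := by
    simp only [Pi.add_apply, add_mul, Finset.sum_add_distrib, Finset.sum_apply, Finset.sum_mul]
    rw [Finset.sum_comm, Finset.mul_sum]
    simp [Pi.single_apply]
  beta_reduce
  rw [h1, h2, Real.exp_add, Real.exp_add]
  ring

/-- Adding the field `2 β` at the vertices of `N` changes the logarithm of the partition function
by an amount whose dependence on the field is controlled by the half log odds at the vertices
of `N`. -/
theorem abs_log_fieldZ_add_sum_single_le (hβ : 0 ≤ β) {A : Finset V} {a : V → V → ℝ}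
    {σ : V → Bool} (N : Finset V)
    (ha : ∀ w ∈ N ∩ A, ∀ h h' : V → ℝ,
      |halfLogOdds G β A w σ h - halfLogOdds G β A w σ h'| ≤ ∑ u, a w u * |h u - h' u|)
    (h h' : V → ℝ) :
    |(Real.log (fieldZ G β A σ (h + ∑ w ∈ N, Pi.single w (2 * β))) -
        Real.log (fieldZ G β A σ h)) -
      (Real.log (fieldZ G β A σ (h' + ∑ w ∈ N, Pi.single w (2 * β))) -
        Real.log (fieldZ G β A σ h'))| ≤
      2 * Real.tanh β * ∑ w ∈ N ∩ A, ∑ u, a w u * |h u - h' u| := by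
  -- The field is added one vertex at a time. The two fields are shifted equally, so their
  -- difference, and hence the bound `ha`, is unaffected.
  induction N using Finset.induction_on with
  | empty => simp
  | insert w N hw ih =>
    have ih' := ih fun x hx => ha x (Finset.inter_subset_inter_right
      (Finset.subset_insert w N) hx)
    have ht : 0 ≤ 2 * Real.tanh β := by
      rw [Real.tanh_eq_sinh_div_cosh]
      have := Real.sinh_nonneg_iff.2 hβ
      have := Real.cosh_pos β
      positivity
    have hrw : ∀ g : V → ℝ, g + ∑ x ∈ insert w N, Pi.single x (2 * β) =
        (g + ∑ x ∈ N, Pi.single x (2 * β)) + Pi.single w (2 * β) := by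
      intro g
      rw [Finset.sum_insert hw, add_assoc, add_comm (∑ x ∈ N, Pi.single x (2 * β)) _]
    rw [hrw, hrw]
    set g := h + ∑ x ∈ N, Pi.single x (2 * β) with hg
    set g' := h' + ∑ x ∈ N, Pi.single x (2 * β) with hg'
    have hgg : ∀ u, |g u - g' u| = |h u - h' u| := fun u => by simp [hg, hg']
    by_cases hwA : w ∈ A
    · rw [Finset.insert_inter_of_mem hwA, Finset.sum_insert (by simp [hw])]
      have e := log_fieldZ_add_single_of_mem G β hwA σ g (2 * β)
      have e' := log_fieldZ_add_single_of_mem G β hwA σ g' (2 * β)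
      have hl := abs_log_cosh_sub_le hβ (halfLogOdds G β A w σ g) (halfLogOdds G β A w σ g')
      have hl' := ha w (by simp [hwA]) g g'
      simp only [hgg] at hl'
      have := hl.trans (mul_le_mul_of_nonneg_left hl' ht)
      rw [← e, ← e'] at this
      rw [abs_le] at this ih' ⊢
      constructor <;> linarith [this.1, this.2, ih'.1, ih'.2]
    -- The spin at a vertex outside `A` is frozen: it contributes the same factor for both fields,
    -- which cancels.
    · rw [Finset.insert_inter_of_notMem hwA]
      rw [fieldZ_add_single_of_notMem G β hwA, fieldZ_add_single_of_notMem G β hwA,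
        Real.log_mul (Real.exp_pos _).ne' (fieldZ_pos ..).ne',
        Real.log_mul (Real.exp_pos _).ne' (fieldZ_pos ..).ne']
      convert ih' using 2
      ring

/-- This is the recursion step: `v` leaves the domain, and its two spin values differ by a field on
the neighbours. -/
theorem halfLogOdds_eq (A : Finset V) (v : V) (σ : V → Bool) (h : V → ℝ) :
    halfLogOdds G β A v σ h = h v +
      (Real.log (fieldZ G β (A.erase v) (Function.update σ v false)
        (h + ∑ w ∈ G.neighborFinset v, Pi.single w (2 * β))) -
        Real.log (fieldZ G β (A.erase v) (Function.update σ v false) h)) / 2 := by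
  rw [halfLogOdds, fieldZ_update_true G β (Finset.notMem_erase v A),
    Real.log_mul (Real.exp_pos _).ne' (fieldZ_pos ..).ne', Real.log_exp]
  ring

theorem halfLogOdds_update_true {A : Finset V} {u v : V} (hu : u ∉ A) (huv : u ≠ v) (σ : V → Bool)
    (h : V → ℝ) :
    halfLogOdds G β A v (Function.update σ u true) h =
      halfLogOdds G β A v (Function.update σ u false)
        (h + ∑ w ∈ G.neighborFinset u, Pi.single w (2 * β)) := by
  have hu' : u ∉ A.erase v := fun h => hu (Finset.mem_of_mem_erase h)
  have : ∀ b, Real.log (fieldZ G β (A.erase v)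
      (Function.update (Function.update σ u true) v b) h) = 2 * h u +
      Real.log (fieldZ G β (A.erase v) (Function.update (Function.update σ u false) v b)
        (h + ∑ w ∈ G.neighborFinset u, Pi.single w (2 * β))) := by
    intro b
    rw [Function.update_comm huv, Function.update_comm huv, fieldZ_update_true G β hu',
      Real.log_mul (Real.exp_pos _).ne' (fieldZ_pos ..).ne', Real.log_exp]
  rw [halfLogOdds, halfLogOdds, this, this]
  ring

end Field

/-! ### Balls and their cardinality -/

section Ball

variable {V : Type*} [Fintype V] [DecidableEq V] (G : SimpleGraph V) [DecidableRel G.Adj]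

/-- The vertices at distance less than `k` from `v`. -/
def ball : ℕ → V → Finset V
  | 0, _ => ∅
  | k + 1, v => insert v ((G.neighborFinset v).biUnion (ball k))

theorem mem_ball_succ_self (k : ℕ) (v : V) : v ∈ ball G (k + 1) v := by simp [ball]

theorem ball_subset_ball_succ_of_adj {v w : V} (h : G.Adj v w) (k : ℕ) :
    ball G k w ⊆ ball G (k + 1) v := by
  intro u hu
  simp only [ball, Finset.mem_insert, Finset.mem_biUnion, SimpleGraph.mem_neighborFinset]
  exact Or.inr ⟨w, h, hu⟩

theorem mem_ball_succ_of_adj {u w : V} (h : G.Adj w u) (k : ℕ) :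
    ∀ {v : V}, w ∈ ball G k v → u ∈ ball G (k + 1) v := by
  induction k with
  | zero => intro v hw; simp [ball] at hw
  | succ k ih =>
    intro v hw
    rw [ball, Finset.mem_insert, Finset.mem_biUnion] at hw
    rcases hw with rfl | ⟨x, hx, hw⟩
    · exact ball_subset_ball_succ_of_adj G h _ (mem_ball_succ_self G k u)
    · exact ball_subset_ball_succ_of_adj G (by simpa using hx) _ (ih hw)

theorem ball_subset_ball_succ (k : ℕ) : ∀ v : V, ball G k v ⊆ ball G (k + 1) v := by
  induction k with
  | zero => intro v; simp [ball]
  | succ k ih =>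
    intro v
    rw [ball, ball]
    exact Finset.insert_subset_insert _ (Finset.biUnion_mono fun w _ => ih w)

theorem card_ball_le {D : ℕ} (hD : ∀ v, G.degree v ≤ D) (k : ℕ) :
    ∀ v : V, (ball G k v).card ≤ (D + 1) ^ k := by
  induction k with
  | zero => intro v; simp [ball]
  | succ k ih =>
    intro v
    have h1 : ((G.neighborFinset v).biUnion (ball G k)).card ≤ D * (D + 1) ^ k :=
      (Finset.card_biUnion_le_card_mul _ _ _ fun w _ => ih w).trans
        (Nat.mul_le_mul_right _ (by simpa using hD v))
    have h2 := Finset.card_insert_le v ((G.neighborFinset v).biUnion (ball G k))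
    have h3 : 1 ≤ (D + 1) ^ k := Nat.one_le_pow _ _ (Nat.succ_pos _)
    rw [ball, pow_succ]
    nlinarith

end Ball

/-! ### Decay of influence below the threshold -/

section Influence

variable {V : Type*} [Fintype V] [DecidableEq V] (G : SimpleGraph V) [DecidableRel G.Adj]

theorem tanh_nonneg {β : ℝ} (hβ : 0 ≤ β) : 0 ≤ Real.tanh β := by
  rw [Real.tanh_eq_sinh_div_cosh]
  exact div_nonneg (Real.sinh_nonneg_iff.2 hβ) (Real.cosh_pos β).le

/-- The total influence of the external field on the half log odds at a vertex `v` is bounded,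
and the part of it that comes from the field outside a ball around `v` decays exponentially in
the radius. -/
theorem exists_influence {β : ℝ} (hβ : 0 ≤ β) {q : ℕ} (hdeg : ∀ v, G.degree v ≤ q + 1)
    {C : ℝ} (hC : 0 ≤ C) (hCeq : 1 + q * Real.tanh β * C = C) (A : Finset V) :
    ∀ v ∈ A, ∃ a : V → ℝ, (∀ u, 0 ≤ a u) ∧
      (∀ σ h h', |halfLogOdds G β A v σ h - halfLogOdds G β A v σ h'| ≤
        ∑ u, a u * |h u - h' u|) ∧
      ∑ u, a u ≤ 1 + Real.tanh β * (G.neighborFinset v ∩ A).card * C ∧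
      ∀ j, ∑ u with u ∉ ball G (j + 1) v, a u ≤
        Real.tanh β * (G.neighborFinset v ∩ A).card * (C * (q * Real.tanh β) ^ j) := by
  have ht := tanh_nonneg hβ
  have hθ : 0 ≤ q * Real.tanh β := by positivity
  induction A using Finset.strongInduction with
  | H A ih =>
  intro v hv
  -- Once `v` is deleted, its neighbour `w` has at most q neighbours left, and 1 + q tanh β C = C
  -- closes the recursion. The index j = 0 records the total influence, since `ball G 0 w` is empty.
  have hnb : ∀ w, ∃ a : V → ℝ, w ∈ G.neighborFinset v ∩ A.erase v → (∀ u, 0 ≤ a u) ∧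
      (∀ σ h h', |halfLogOdds G β (A.erase v) w σ h - halfLogOdds G β (A.erase v) w σ h'| ≤
        ∑ u, a u * |h u - h' u|) ∧
      ∀ j, ∑ u with u ∉ ball G j w, a u ≤ C * (q * Real.tanh β) ^ j := by
    intro w
    by_cases hw : w ∈ G.neighborFinset v ∩ A.erase v
    · obtain ⟨hvw, hwA⟩ := Finset.mem_inter.1 hw
      rw [SimpleGraph.mem_neighborFinset] at hvw
      obtain ⟨a, h0, h1, h2, h3⟩ := ih _ (Finset.erase_ssubset hv) w hwA
      have hcard : ((G.neighborFinset w ∩ A.erase v).card : ℝ) ≤ q := by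
        have hlt : (G.neighborFinset w ∩ A.erase v).card < (G.neighborFinset w).card := by
          refine Finset.card_lt_card ⟨Finset.inter_subset_left, fun h => ?_⟩
          have := h (by simpa using hvw.symm : v ∈ G.neighborFinset w)
          simp at this
        have hd := hdeg w
        rw [← SimpleGraph.card_neighborFinset_eq_degree] at hd
        exact_mod_cast (by omega : (G.neighborFinset w ∩ A.erase v).card ≤ q)
      have hcard' : Real.tanh β * (G.neighborFinset w ∩ A.erase v).card ≤ q * Real.tanh β := by
        rw [mul_comm]; gcongr
      refine ⟨a, fun _ => ⟨h0, h1, fun j => ?_⟩⟩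
      cases j with
      | zero =>
        simp only [ball, Finset.notMem_empty, not_false_eq_true, Finset.filter_true, pow_zero,
          mul_one]
        refine h2.trans ?_
        have := mul_le_mul_of_nonneg_right hcard' hC
        linarith
      | succ j =>
        refine (h3 j).trans ?_
        have := mul_le_mul_of_nonneg_right hcard' (mul_nonneg hC (pow_nonneg hθ j))
        refine this.trans (le_of_eq ?_)
        ring
    · exact ⟨0, fun h => absurd h hw⟩
  choose a ha using hnb
  set N := G.neighborFinset v ∩ A.erase v with hN
  have hNcard : (N.card : ℝ) ≤ (G.neighborFinset v ∩ A).card := by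
    exact_mod_cast Finset.card_le_card
      (Finset.inter_subset_inter_left (Finset.erase_subset v A))
  have hsumN : ∀ (F : V → ℝ) (c : ℝ), 0 ≤ c → (∀ w ∈ N, F w ≤ c) →
      Real.tanh β * ∑ w ∈ N, F w ≤ Real.tanh β * (G.neighborFinset v ∩ A).card * c := by
    intro F c hc hF
    rw [mul_assoc]
    refine mul_le_mul_of_nonneg_left ?_ ht
    refine (Finset.sum_le_card_nsmul _ _ _ hF).trans ?_
    rw [nsmul_eq_mul]
    gcongr
  -- Weight 1 for the field at `v` itself; for each neighbour, tanh β is the Lipschitz constant 2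
  -- tanh β times the 1/2 in `halfLogOdds_eq`.
  refine ⟨fun u => (if u = v then 1 else 0) + Real.tanh β * ∑ w ∈ N, a w u, ?_, ?_, ?_, ?_⟩
  · intro u
    have : 0 ≤ ∑ w ∈ N, a w u := Finset.sum_nonneg fun w hw => (ha w hw).1 u
    have : 0 ≤ Real.tanh β * ∑ w ∈ N, a w u := mul_nonneg ht this
    beta_reduce
    split_ifs <;> linarith
  · intro σ h h'
    have key := abs_log_fieldZ_add_sum_single_le G β hβ (A := A.erase v) (a := a)
      (σ := Function.update σ v false) (G.neighborFinset v) (fun w hw => (ha w hw).2.1 _) h h'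
    have hsum : ∑ u, ((if u = v then 1 else 0) + Real.tanh β * ∑ w ∈ N, a w u) * |h u - h' u| =
        |h v - h' v| + Real.tanh β * ∑ w ∈ N, ∑ u, a w u * |h u - h' u| := by
      simp only [add_mul, Finset.sum_add_distrib, ite_mul, one_mul, zero_mul,
        Finset.sum_ite_eq', Finset.mem_univ, if_true]
      congr 1
      rw [Finset.sum_comm, Finset.mul_sum]
      refine Finset.sum_congr rfl fun u _ => ?_
      rw [mul_assoc, Finset.sum_mul]
    rw [hsum, halfLogOdds_eq, halfLogOdds_eq]
    have h1 := abs_le.1 key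
    have h2 := abs_le.1 (le_refl |h v - h' v|)
    rw [abs_le]
    constructor <;> linarith [h1.1, h1.2, h2.1, h2.2]
  · rw [Finset.sum_add_distrib]
    simp only [Finset.sum_ite_eq', Finset.mem_univ, if_true]
    rw [← Finset.mul_sum, Finset.sum_comm]
    refine add_le_add_right ?_ _
    refine hsumN _ _ hC fun w hw => ?_
    simpa [ball] using (ha w hw).2.2 0
  · intro j
    rw [Finset.sum_add_distrib, ← Finset.mul_sum, Finset.sum_comm]
    have hz : ∑ u with u ∉ ball G (j + 1) v, (if u = v then (1 : ℝ) else 0) = 0 := by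
      refine Finset.sum_eq_zero fun u hu => if_neg ?_
      rintro rfl
      exact (Finset.mem_filter.1 hu).2 (mem_ball_succ_self G j u)
    rw [hz, zero_add]
    refine hsumN _ _ (mul_nonneg hC (pow_nonneg hθ j)) fun w hw => ?_
    refine le_trans ?_ ((ha w hw).2.2 j)
    have hvw : G.Adj v w := by simpa using (Finset.mem_inter.1 hw).1
    refine Finset.sum_le_sum_of_subset_of_nonneg (fun u hu => ?_) fun u _ _ => (ha w hw).1 u
    simp only [Finset.mem_filter, Finset.mem_univ, true_and] at hu ⊢
    exact fun h => hu (ball_subset_ball_succ_of_adj G hvw j h)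

/-- The total influence of the boundary spins of a ball on the half log odds at its centre decays
exponentially in the radius. -/
theorem exists_boundary_influence {β : ℝ} (hβ : 0 ≤ β) {q : ℕ} (hdeg : ∀ v, G.degree v ≤ q + 1)
    {C : ℝ} (hC : 0 ≤ C) (hCeq : 1 + q * Real.tanh β * C = C) (k : ℕ) (v : V) :
    ∃ b : V → ℝ, (∀ u, 0 ≤ b u) ∧
      (∀ u ∉ ball G (k + 2) v, ∀ σ,
        |halfLogOdds G β (ball G (k + 2) v) v (Function.update σ u true) 0 -
          halfLogOdds G β (ball G (k + 2) v) v (Function.update σ u false) 0| ≤ b u) ∧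
      ∑ u with u ∉ ball G (k + 2) v, b u ≤
        2 * β * (q + 1) ^ 2 * C * (q * Real.tanh β) ^ k := by
  have ht := tanh_nonneg hβ
  have hθ : 0 ≤ q * Real.tanh β := by positivity
  obtain ⟨a, h0, h1, -, h3⟩ := exists_influence G hβ hdeg hC hCeq (ball G (k + 2) v) v
    (mem_ball_succ_self G _ v)
  -- Flipping the spin at `u` amounts to a field 2β on each neighbour of `u`.
  refine ⟨fun u => 2 * β * ∑ w ∈ G.neighborFinset u, a w, fun u => ?_, fun u hu σ => ?_, ?_⟩
  · have : 0 ≤ ∑ w ∈ G.neighborFinset u, a w := Finset.sum_nonneg fun w _ => h0 w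
    positivity
  · have huv : u ≠ v := by rintro rfl; exact hu (mem_ball_succ_self G _ u)
    rw [halfLogOdds_update_true G β hu huv]
    refine (h1 _ _ _).trans (le_of_eq ?_)
    simp [Finset.sum_apply, Pi.single_apply, Finset.mul_sum]
    simp only [abs_of_nonneg hβ, apply_ite abs, abs_zero, mul_ite, mul_zero, abs_mul, abs_two]
    rw [← Finset.sum_filter]
    refine Finset.sum_congr (by ext; simp) fun x _ => by ring
  · rw [← Finset.mul_sum]
    -- Double counting: a neighbour of a vertex outside the ball of radius k + 2 lies outside the
    -- one of radius k + 1.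
    have hswap : ∑ u with u ∉ ball G (k + 2) v, ∑ w ∈ G.neighborFinset u, a w ≤
        ∑ w with w ∉ ball G (k + 1) v, ∑ u ∈ G.neighborFinset w, a w := by
      rw [Finset.sum_comm' (t' := Finset.univ.filter fun w => w ∉ ball G (k + 1) v)
        (s' := fun w => (G.neighborFinset w).filter fun u => u ∉ ball G (k + 2) v)]
      · exact Finset.sum_le_sum fun w _ => Finset.sum_le_sum_of_subset_of_nonneg
          (Finset.filter_subset _ _) fun _ _ _ => h0 w
      · intro u w
        simp only [Finset.mem_filter, Finset.mem_univ, true_and, SimpleGraph.mem_neighborFinset]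
        exact ⟨fun ⟨h, huw⟩ => ⟨⟨huw.symm, h⟩, fun hw => h (mem_ball_succ_of_adj G huw.symm _ hw)⟩,
          fun ⟨⟨hwu, h⟩, _⟩ => ⟨h, hwu.symm⟩⟩
    have hdeg' : ∑ w with w ∉ ball G (k + 1) v, ∑ u ∈ G.neighborFinset w, a w ≤
        (q + 1) * ∑ w with w ∉ ball G (k + 1) v, a w := by
      rw [Finset.mul_sum]
      refine Finset.sum_le_sum fun w _ => ?_
      rw [Finset.sum_const, nsmul_eq_mul, SimpleGraph.card_neighborFinset_eq_degree]
      exact mul_le_mul_of_nonneg_right (by exact_mod_cast hdeg w) (h0 w)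
    have hcard : Real.tanh β * (G.neighborFinset v ∩ ball G (k + 2) v).card ≤ q + 1 := by
      have h5 : ((G.neighborFinset v ∩ ball G (k + 2) v).card : ℝ) ≤ q + 1 := by
        have h6 := (Finset.card_le_card (Finset.inter_subset_left (s₁ := G.neighborFinset v)
          (s₂ := ball G (k + 2) v))).trans
          ((G.card_neighborFinset_eq_degree v).le.trans (hdeg v))
        exact_mod_cast h6
      have := mul_le_mul (Real.tanh_lt_one β).le h5 (by positivity) zero_le_one
      linarith
    have hfin : ∑ w with w ∉ ball G (k + 1) v, a w ≤
        (q + 1) * (C * (q * Real.tanh β) ^ k) :=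
      (h3 k).trans (mul_le_mul_of_nonneg_right hcard (by positivity))
    calc 2 * β * ∑ u with u ∉ ball G (k + 2) v, ∑ w ∈ G.neighborFinset u, a w
        ≤ 2 * β * ((q + 1) * ((q + 1) * (C * (q * Real.tanh β) ^ k))) := by
          refine mul_le_mul_of_nonneg_left ?_ (by positivity)
          exact (hswap.trans hdeg').trans (mul_le_mul_of_nonneg_left hfin (by positivity))
      _ = _ := by ring

end Influence

/-! ### Heat-bath updates as orthogonal projections -/

section BlockAverage

variable {V : Type*} [Fintype V] [DecidableEq V]

theorem monotone_of_update_le {f : (V → Bool) → ℝ}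
    (hf : ∀ σ u, f (Function.update σ u false) ≤ f (Function.update σ u true)) : Monotone f := by
  intro σ τ hστ
  have key : ∀ s : Finset V, f σ ≤ f (s.piecewise τ σ) := by
    intro s
    induction s using Finset.induction_on with
    | empty => simp
    | insert u s hu ih =>
      refine ih.trans ?_
      rw [Finset.piecewise_insert]
      have h1 : s.piecewise τ σ = Function.update (s.piecewise τ σ) u (σ u) := by
        conv_lhs => rw [← Function.update_eq_self u (s.piecewise τ σ)]
        rw [Finset.piecewise_eq_of_notMem s _ _ hu]
      have h2 := hστ u
      have h3 := hf (s.piecewise τ σ) u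
      conv_lhs => rw [h1]
      cases hσ : σ u <;> cases hτ : τ u
      · exact le_rfl
      · exact h3
      · rw [hσ, hτ] at h2; exact absurd (h2 rfl) (by simp)
      · exact le_rfl
  simpa using key Finset.univ

variable (G : SimpleGraph V) [DecidableRel G.Adj] (β : ℝ)

/-- The heat-bath update of the block `A` as an operator on functions. -/
def blockAvg (A : Finset V) : Module.End ℝ ((V → Bool) → ℝ) := (heatBath G β A).mulVecLin

theorem sum_isingWeight_pos : 0 < ∑ η : V → Bool, isingWeight G β η :=
  Finset.sum_pos (fun σ _ => isingWeight_pos G β σ) Finset.univ_nonempty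

theorem fiberSum_one (A : Finset V) (σ : V → Bool) :
    fiberSum G β A σ 1 = ∑ τ with AgreeOff A σ τ, isingWeight G β τ := by
  simp [fiberSum]

theorem blockAvg_apply (A : Finset V) (f : (V → Bool) → ℝ) (σ : V → Bool) :
    blockAvg G β A f σ = fiberSum G β A σ f / fiberSum G β A σ 1 := by
  have hZ := (sum_isingWeight_pos G β).ne'
  rw [fiberSum_one, blockAvg, Matrix.mulVecLin_apply, Matrix.mulVec, dotProduct, fiberSum,
    Finset.sum_filter, Finset.sum_div]
  refine Finset.sum_congr rfl fun τ _ => ?_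
  simp only [heatBath, Matrix.of_apply, gibbs, ← Finset.sum_div, ite_mul, zero_mul]
  split_ifs with h
  · rw [div_div_div_cancel_right₀ hZ]
    ring
  · simp

theorem blockAvg_one (A : Finset V) : blockAvg G β A 1 = 1 := by
  ext σ
  rw [blockAvg_apply, div_self (fiberSum_one_pos G β A σ).ne', Pi.one_apply]

theorem blockAvg_nonneg (A : Finset V) {f : (V → Bool) → ℝ} (hf : 0 ≤ f) :
    0 ≤ blockAvg G β A f := by
  intro σ
  rw [blockAvg_apply]
  exact div_nonneg (Finset.sum_nonneg fun τ _ => mul_nonneg (isingWeight_pos G β τ).le (hf τ))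
    (fiberSum_one_pos G β A σ).le

theorem blockAvg_congr {A : Finset V} {σ τ : V → Bool} (h : AgreeOff A σ τ)
    (f : (V → Bool) → ℝ) : blockAvg G β A f σ = blockAvg G β A f τ := by
  rw [blockAvg_apply, blockAvg_apply, fiberSum_congr G β h, fiberSum_congr G β h]

theorem blockAvg_eq_self {A : Finset V} {f : (V → Bool) → ℝ}
    (hf : ∀ σ τ, AgreeOff A σ τ → f σ = f τ) : blockAvg G β A f = f := by
  ext σ
  rw [blockAvg_apply, div_eq_iff (fiberSum_one_pos G β A σ).ne', fiberSum, fiberSum,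
    Finset.mul_sum]
  refine Finset.sum_congr rfl fun τ hτ => ?_
  rw [hf σ τ (Finset.mem_filter.1 hτ).2]
  simp [mul_comm]

theorem blockAvg_blockAvg_of_subset_right {A B : Finset V} (h : B ⊆ A) (f : (V → Bool) → ℝ) :
    blockAvg G β B (blockAvg G β A f) = blockAvg G β A f :=
  blockAvg_eq_self G β fun _ _ h' => blockAvg_congr G β (h'.mono h) f

/-- The unnormalized inner product of the Gibbs distribution. -/
def pairing (f g : (V → Bool) → ℝ) : ℝ := ∑ σ, isingWeight G β σ * (f σ * g σ)

theorem pairing_comm (f g : (V → Bool) → ℝ) : pairing G β f g = pairing G β g f := by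
  simp only [pairing, mul_comm]

theorem pairing_add_left (f f' g : (V → Bool) → ℝ) :
    pairing G β (f + f') g = pairing G β f g + pairing G β f' g := by
  simp only [pairing, Pi.add_apply, add_mul, mul_add, Finset.sum_add_distrib]

theorem pairing_smul_left (c : ℝ) (f g : (V → Bool) → ℝ) :
    pairing G β (c • f) g = c * pairing G β f g := by
  simp only [pairing, Pi.smul_apply, smul_eq_mul, Finset.mul_sum]
  exact Finset.sum_congr rfl fun _ _ => by ring

theorem pairing_smul_right (c : ℝ) (f g : (V → Bool) → ℝ) :
    pairing G β f (c • g) = c * pairing G β f g := by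
  rw [pairing_comm, pairing_smul_left, pairing_comm]

theorem pairing_single (f : (V → Bool) → ℝ) (σ : V → Bool) :
    pairing G β f (Pi.single σ 1) = isingWeight G β σ * f σ := by
  simp [pairing, Pi.single_apply]

theorem ext_pairing {f f' : (V → Bool) → ℝ} (h : ∀ g, pairing G β f g = pairing G β f' g) :
    f = f' := by
  ext σ
  have := h (Pi.single σ 1)
  rw [pairing_single, pairing_single] at this
  exact mul_left_cancel₀ (isingWeight_pos G β σ).ne' this

/-- Detailed balance: the kernel weight is symmetric because the normalization is constant on
fibers. -/
theorem pairing_blockAvg (A : Finset V) (f g : (V → Bool) → ℝ) :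
    pairing G β (blockAvg G β A f) g = pairing G β f (blockAvg G β A g) := by
  have h : ∀ f g : (V → Bool) → ℝ, pairing G β (blockAvg G β A f) g =
      ∑ σ, ∑ τ, if AgreeOff A σ τ then
        isingWeight G β σ * isingWeight G β τ * (f τ * g σ) / fiberSum G β A σ 1 else 0 := by
    intro f g
    refine Finset.sum_congr rfl fun σ _ => ?_
    rw [blockAvg_apply, fiberSum, Finset.sum_filter, div_mul_eq_mul_div, mul_div_assoc',
      Finset.sum_mul, Finset.mul_sum, Finset.sum_div]
    refine Finset.sum_congr rfl fun τ _ => ?_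
    split_ifs
    · ring
    · simp
  rw [pairing_comm G β f, h, h, Finset.sum_comm]
  refine Finset.sum_congr rfl fun σ _ => Finset.sum_congr rfl fun τ _ => ?_
  by_cases hst : AgreeOff A σ τ
  · rw [if_pos hst, if_pos hst.symm, fiberSum_congr G β hst]
    ring
  · rw [if_neg hst, if_neg fun h => hst h.symm]

theorem blockAvg_blockAvg_of_subset_left {A B : Finset V} (h : B ⊆ A) (f : (V → Bool) → ℝ) :
    blockAvg G β A (blockAvg G β B f) = blockAvg G β A f :=
  ext_pairing G β fun g => by
    rw [pairing_blockAvg, pairing_blockAvg, blockAvg_blockAvg_of_subset_right G β h,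
      ← pairing_blockAvg]

end BlockAverage

/-! ### Holley and FKG inequalities -/

section Monotonicity

variable {V : Type*} [Fintype V] [DecidableEq V]
variable (G : SimpleGraph V) [DecidableRel G.Adj] {β : ℝ}

/-- One instance of the four functions theorem serves twice: g = 1 gives monotonicity in the
boundary condition, σ = σ' gives positive correlation. -/
theorem fiberSum_mul_fiberSum_le (hβ : 0 ≤ β) (A : Finset V) {σ σ' : V → Bool} (hσ : σ ≤ σ')
    {f g : (V → Bool) → ℝ} (hf : Monotone f) (hg : Monotone g) (hf0 : 0 ≤ f) (hg0 : 0 ≤ g) :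
    fiberSum G β A σ f * fiberSum G β A σ' g ≤
      fiberSum G β A σ 1 * fiberSum G β A σ' (f * g) := by
  have hnn : ∀ (σ : V → Bool) {φ : (V → Bool) → ℝ}, 0 ≤ φ →
      0 ≤ fun τ => if AgreeOff A σ τ then isingWeight G β τ * φ τ else 0 := by
    intro σ φ hφ τ
    simp only [Pi.zero_apply]
    split_ifs
    · exact mul_nonneg (isingWeight_pos G β τ).le (hφ τ)
    · exact le_rfl
  have := four_functions_theorem_univ
    (fun τ => if AgreeOff A σ τ then isingWeight G β τ * f τ else 0)
    (fun τ => if AgreeOff A σ' τ then isingWeight G β τ * g τ else 0)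
    (fun τ => if AgreeOff A σ τ then isingWeight G β τ * (1 : (V → Bool) → ℝ) τ else 0)
    (fun τ => if AgreeOff A σ' τ then isingWeight G β τ * (f * g) τ else 0)
    (hnn σ hf0) (hnn σ' hg0) (hnn σ zero_le_one) (hnn σ' (mul_nonneg hf0 hg0)) ?_
  · simpa only [fiberSum, Finset.sum_filter] using this
  · intro a b
    by_cases ha : AgreeOff A σ a
    · by_cases hb : AgreeOff A σ' b
      · have h1 : AgreeOff A σ (a ⊓ b) := fun v hv => by
          rw [Pi.inf_apply, ha v hv, hb v hv]
          exact inf_eq_left.2 (hσ v)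
        have h2 : AgreeOff A σ' (a ⊔ b) := fun v hv => by
          rw [Pi.sup_apply, ha v hv, hb v hv]
          exact sup_eq_right.2 (hσ v)
        rw [if_pos ha, if_pos hb, if_pos h1, if_pos h2, Pi.one_apply, Pi.mul_apply, mul_one,
          mul_mul_mul_comm, ← mul_assoc (isingWeight G β (a ⊓ b))]
        have hfg : f a * g b ≤ f (a ⊔ b) * g (a ⊔ b) :=
          mul_le_mul (hf le_sup_left) (hg le_sup_right) (hg0 _) (hf0 _)
        exact mul_le_mul (isingWeight_mul_le G hβ a b) hfg (mul_nonneg (hf0 _) (hg0 _))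
          (mul_nonneg (isingWeight_pos G β _).le (isingWeight_pos G β _).le)
      · rw [if_neg hb, mul_zero]
        exact mul_nonneg (hnn σ zero_le_one _) (hnn σ' (mul_nonneg hf0 hg0) _)
    · rw [if_neg ha, zero_mul]
      exact mul_nonneg (hnn σ zero_le_one _) (hnn σ' (mul_nonneg hf0 hg0) _)

theorem exists_add_const_nonneg (f : (V → Bool) → ℝ) : ∃ c : ℝ, 0 ≤ f + c • 1 := by
  refine ⟨∑ σ, |f σ|, fun σ => ?_⟩
  have h1 := Finset.single_le_sum (f := fun σ => |f σ|) (fun _ _ => abs_nonneg _)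
    (Finset.mem_univ σ)
  have h2 := neg_abs_le (f σ)
  simp only [Pi.zero_apply, Pi.add_apply, Pi.smul_apply, Pi.one_apply, smul_eq_mul, mul_one]
  linarith

theorem monotone_add_const {f : (V → Bool) → ℝ} (hf : Monotone f) (c : ℝ) :
    Monotone (f + c • 1) := fun σ τ h => by simpa using hf h

theorem monotone_blockAvg (hβ : 0 ≤ β) (A : Finset V) {f : (V → Bool) → ℝ} (hf : Monotone f) :
    Monotone (blockAvg G β A f) := by
  intro σ τ hστ
  -- The four functions theorem needs nonnegative functions; block averages fix constants, so a
  -- shift is harmless.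
  obtain ⟨c, hc⟩ := exists_add_const_nonneg f
  have h := fiberSum_mul_fiberSum_le G hβ A hστ (monotone_add_const hf c) (g := 1)
    monotone_const hc zero_le_one
  rw [mul_one, mul_comm (fiberSum G β A σ 1), ← div_le_div_iff₀ (fiberSum_one_pos G β A σ)
    (fiberSum_one_pos G β A τ), ← blockAvg_apply, ← blockAvg_apply, map_add, map_smul,
    blockAvg_one] at h
  simpa using h

theorem blockAvg_mul_blockAvg_le (hβ : 0 ≤ β) (A : Finset V) {f g : (V → Bool) → ℝ}
    (hf : Monotone f) (hg : Monotone g) :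
    blockAvg G β A f * blockAvg G β A g ≤ blockAvg G β A (f * g) := by
  intro σ
  obtain ⟨c, hc⟩ := exists_add_const_nonneg f
  obtain ⟨c', hc'⟩ := exists_add_const_nonneg g
  have h := fiberSum_mul_fiberSum_le G hβ A (le_refl σ) (monotone_add_const hf c)
    (monotone_add_const hg c') hc hc'
  have hp := fiberSum_one_pos G β A σ
  have h' : blockAvg G β A (f + c • 1) σ * blockAvg G β A (g + c' • 1) σ ≤
      blockAvg G β A ((f + c • 1) * (g + c' • 1)) σ := by
    rw [blockAvg_apply, blockAvg_apply, blockAvg_apply, div_mul_div_comm,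
      div_le_div_iff₀ (mul_pos hp hp) hp]
    nlinarith
  have e : (f + c • 1) * (g + c' • 1) = f * g + c' • f + c • g + (c * c') • 1 := by
    ext τ
    simp
    ring
  rw [e] at h'
  simp only [map_add, map_smul, blockAvg_one, Pi.add_apply, Pi.smul_apply, Pi.one_apply,
    smul_eq_mul, Pi.mul_apply] at h' ⊢
  linarith

/-- Since E_A is a self-adjoint projection, the left side is the integral of E_A f · E_A g, which
FKG on each fiber bounds by that of E_A (f g). -/
theorem pairing_blockAvg_le (hβ : 0 ≤ β) (A : Finset V) {f g : (V → Bool) → ℝ}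
    (hf : Monotone f) (hg : Monotone g) :
    pairing G β (blockAvg G β A f) g ≤ pairing G β f g := by
  have h1 : pairing G β (blockAvg G β A f) g =
      pairing G β (blockAvg G β A f * blockAvg G β A g) 1 := by
    rw [← blockAvg_blockAvg_of_subset_right G β subset_rfl, pairing_blockAvg,
      blockAvg_blockAvg_of_subset_right G β subset_rfl]
    simp [pairing]
  have h2 : pairing G β f g = pairing G β (blockAvg G β A (f * g)) 1 := by
    rw [pairing_blockAvg, blockAvg_one]
    simp [pairing]
  rw [h1, h2]
  refine Finset.sum_le_sum fun σ _ => mul_le_mul_of_nonneg_left ?_ (isingWeight_pos G β σ).le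
  exact mul_le_mul_of_nonneg_right (blockAvg_mul_blockAvg_le G hβ A hf hg σ) zero_le_one

/-- Updating a larger block brings two increasing functions closer to independence. -/
theorem pairing_blockAvg_le_of_subset (hβ : 0 ≤ β) {A B : Finset V} (hBA : B ⊆ A)
    {f g : (V → Bool) → ℝ} (hf : Monotone f) (hg : Monotone g) :
    pairing G β (blockAvg G β A f) g ≤ pairing G β (blockAvg G β B f) g := by
  -- Applied to E_B f and E_B g, because E_B E_A E_B = E_A and E_B² = E_B.
  have h := pairing_blockAvg_le G hβ A (monotone_blockAvg G hβ B hf) (monotone_blockAvg G hβ B hg)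
  rw [blockAvg_blockAvg_of_subset_left G β hBA, ← pairing_blockAvg, ← pairing_blockAvg,
    blockAvg_blockAvg_of_subset_right G β hBA, blockAvg_blockAvg_of_subset_right G β subset_rfl]
    at h
  exact h

end Monotonicity

/-! ### Single-spin means, locality and a lower bound on conditional probabilities -/

section Locality

variable {V : Type*} [Fintype V] [DecidableEq V]
variable (G : SimpleGraph V) [DecidableRel G.Adj] (β : ℝ)

theorem blockAvg_spin {A : Finset V} {v : V} (hv : v ∈ A) (σ : V → Bool) :
    blockAvg G β A (fun τ => spin (τ v)) σ = Real.tanh (halfLogOdds G β A v σ 0) := by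
  have hz : ∀ b, fieldZ G β (A.erase v) (Function.update σ v b) 0 =
      fiberSum G β (A.erase v) (Function.update σ v b) 1 := by
    intro b
    simp [fieldZ, fiberSum]
  have hs : ∀ b, fiberSum G β (A.erase v) (Function.update σ v b) (fun τ => spin (τ v)) =
      spin b * fiberSum G β (A.erase v) (Function.update σ v b) 1 := by
    intro b
    rw [fiberSum, fiberSum, Finset.mul_sum]
    refine Finset.sum_congr rfl fun τ hτ => ?_
    have : τ v = b := by simpa using (Finset.mem_filter.1 hτ).2 v (Finset.notMem_erase v A)
    rw [this]
    simp [mul_comm]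
  rw [blockAvg_apply, fiberSum_eq_add G β hv, fiberSum_eq_add G β hv, hs, hs, halfLogOdds, hz, hz,
    tanh_half_log_sub (fiberSum_one_pos ..) (fiberSum_one_pos ..)]
  simp [spin, sub_eq_add_neg]

/-- Flipping `u` multiplies all weights of the fiber by a common factor, which cancels in the
average. -/
theorem blockAvg_update_eq {A : Finset V} {u : V} (hu : u ∉ A)
    (hA : ∀ w ∈ A, ¬ G.Adj u w) {f : (V → Bool) → ℝ}
    (hf : ∀ σ, f (Function.update σ u true) = f (Function.update σ u false)) (σ : V → Bool) :
    blockAvg G β A f (Function.update σ u true) =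
      blockAvg G β A f (Function.update σ u false) := by
  have key : ∀ φ : (V → Bool) → ℝ,
      (∀ σ, φ (Function.update σ u true) = φ (Function.update σ u false)) →
      fiberSum G β A (Function.update σ u true) φ =
        Real.exp (2 * β * ∑ w ∈ G.neighborFinset u, spin (σ w)) *
          fiberSum G β A (Function.update σ u false) φ := by
    intro φ hφ
    rw [fiberSum_update_true G β hu, fiberSum, fiberSum, Finset.mul_sum]
    refine Finset.sum_congr rfl fun τ hτ => ?_
    have hag := (Finset.mem_filter.1 hτ).2
    have hτu : τ u = false := by simpa using hag u hu
    have h1 : ∑ w ∈ G.neighborFinset u, spin (τ w) = ∑ w ∈ G.neighborFinset u, spin (σ w) := by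
      refine Finset.sum_congr rfl fun w hw => ?_
      rw [SimpleGraph.mem_neighborFinset] at hw
      rw [hag w fun h => hA w h hw, Function.update_of_ne hw.ne']
    have h2 : φ (Function.update τ u true) = φ τ := by
      rw [hφ, ← hτu, Function.update_eq_self]
    rw [h1, h2]
    ring
  rw [blockAvg_apply, blockAvg_apply, key f hf, key 1 fun _ => rfl,
    mul_div_mul_left _ _ (Real.exp_pos _).ne']

theorem fiberSum_empty (σ : V → Bool) (f : (V → Bool) → ℝ) :
    fiberSum G β ∅ σ f = isingWeight G β σ * f σ := by
  have : ({τ | AgreeOff ∅ σ τ} : Finset (V → Bool)) = {σ} := by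
    ext τ
    simp [AgreeOff, funext_iff]
  rw [fiberSum, this, Finset.sum_singleton]

variable {β}

theorem le_blockAvg_singleton (hβ : 0 ≤ β) {D : ℕ} (hD : ∀ v, G.degree v ≤ D) (v : V)
    {f : (V → Bool) → ℝ} (hf : 0 ≤ f) (σ : V → Bool) (b : Bool) :
    (1 + Real.exp (2 * β * D))⁻¹ * f (Function.update σ v b) ≤ blockAvg G β {v} f σ := by
  have hx := sum_neighborFinset_spin_abs_le G σ v
  have hD' : (G.degree v : ℝ) ≤ D := by exact_mod_cast hD v
  obtain ⟨hx1, hx2⟩ := abs_le.1 (hx.trans hD')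
  have e1 : Real.exp (2 * β * ∑ w ∈ G.neighborFinset v, spin (σ w)) ≤ Real.exp (2 * β * D) :=
    Real.exp_le_exp.2 (mul_le_mul_of_nonneg_left hx2 (by positivity))
  have e2 : 1 ≤ Real.exp (2 * β * D) *
      Real.exp (2 * β * ∑ w ∈ G.neighborFinset v, spin (σ w)) := by
    rw [← Real.exp_add]
    refine Real.one_le_exp ?_
    nlinarith
  have hW := isingWeight_pos G β (Function.update σ v false)
  have hp := Real.exp_pos (2 * β * ∑ w ∈ G.neighborFinset v, spin (σ w))
  have hf1 := hf (Function.update σ v true)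
  have hf2 := hf (Function.update σ v false)
  rw [Pi.zero_apply] at hf1 hf2
  have hv : ({v} : Finset V).erase v = ∅ := by simp
  rw [blockAvg_apply, fiberSum_eq_add G β (Finset.mem_singleton_self v),
    fiberSum_eq_add G β (Finset.mem_singleton_self v), hv, fiberSum_empty, fiberSum_empty,
    fiberSum_empty, fiberSum_empty, isingWeight_update_true, Pi.one_apply, Pi.one_apply,
    inv_mul_eq_div]
  set X := Real.exp (2 * β * ∑ w ∈ G.neighborFinset v, spin (σ w))
  set Y := Real.exp (2 * β * D)
  set W := isingWeight G β (Function.update σ v false)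
  set f1 := f (Function.update σ v true)
  set f2 := f (Function.update σ v false)
  have hY : 0 < Y := Real.exp_pos _
  have e3 : W * X * f1 + W * f2 = W * (X * f1 + f2) := by ring
  have e4 : W * X * 1 + W * 1 = W * (X + 1) := by ring
  rw [e3, e4, mul_div_mul_left _ _ hW.ne', div_le_div_iff₀ (by positivity) (by positivity)]
  cases b
  · change f2 * (X + 1) ≤ _
    nlinarith [mul_nonneg hp.le hf1, mul_nonneg (mul_nonneg hp.le hf1) hY.le,
      mul_le_mul_of_nonneg_right e1 hf2]
  · change f1 * (X + 1) ≤ _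
    nlinarith [mul_nonneg hY.le hf2, mul_le_mul_of_nonneg_right e2 hf1]

end Locality

/-! ### The comparison order on operators -/

section Comparison

variable {V : Type*} [Fintype V] [DecidableEq V]
variable (G : SimpleGraph V) [DecidableRel G.Adj] (β : ℝ)

/-- The comparison order of operators on increasing functions: `S` mixes at least as fast
as `T`. -/
def ComparisonLE (S T : Module.End ℝ ((V → Bool) → ℝ)) : Prop :=
  ∀ f g, Monotone f → Monotone g → pairing G β (S f) g ≤ pairing G β (T f) g

/-- Operators that preserve increasing functions and are self-adjoint with respect to the Gibbs
distribution. -/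
structure IsMonotoneReversible (S : Module.End ℝ ((V → Bool) → ℝ)) : Prop where
  monotone : ∀ f, Monotone f → Monotone (S f)
  symm : ∀ f g, pairing G β (S f) g = pairing G β f (S g)

variable {G β}

/-- The outer factor `T` is moved onto g by self-adjointness, where it stays increasing. Neither
product has to be self-adjoint, so sweeps of noncommuting updates are allowed. -/
theorem ComparisonLE.mul {S S' T T' : Module.End ℝ ((V → Bool) → ℝ)}
    (h : ComparisonLE G β S T) (h' : ComparisonLE G β S' T')
    (hS' : ∀ f, Monotone f → Monotone (S' f)) (hT : IsMonotoneReversible G β T) :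
    ComparisonLE G β (S * S') (T * T') := by
  intro f g hf hg
  rw [Module.End.mul_apply, Module.End.mul_apply]
  refine (h _ g (hS' f hf) hg).trans ?_
  rw [hT.symm, hT.symm]
  exact h' f _ hf (hT.monotone g hg)

theorem ComparisonLE.trans {S T U : Module.End ℝ ((V → Bool) → ℝ)}
    (h : ComparisonLE G β S T) (h' : ComparisonLE G β T U) : ComparisonLE G β S U :=
  fun f g hf hg => (h f g hf hg).trans (h' f g hf hg)

theorem IsMonotoneReversible.pow {S : Module.End ℝ ((V → Bool) → ℝ)}
    (hS : IsMonotoneReversible G β S) (k : ℕ) : IsMonotoneReversible G β (S ^ k) := by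
  induction k with
  | zero => exact ⟨fun f hf => by simpa using hf, fun f g => by simp⟩
  | succ k ih =>
    refine ⟨fun f hf => ?_, fun f g => ?_⟩
    · rw [pow_succ, Module.End.mul_apply]
      exact ih.monotone _ (hS.monotone f hf)
    · rw [pow_succ, Module.End.mul_apply, ih.symm, hS.symm, ← Module.End.mul_apply, ← pow_succ',
        ← pow_succ]

theorem ComparisonLE.pow {S T : Module.End ℝ ((V → Bool) → ℝ)} (h : ComparisonLE G β S T)
    (hS : IsMonotoneReversible G β S) (hT : IsMonotoneReversible G β T) (k : ℕ) :
    ComparisonLE G β (S ^ k) (T ^ k) := by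
  induction k with
  | zero => exact fun f g _ _ => le_rfl
  | succ k ih =>
    rw [pow_succ', pow_succ']
    exact h.mul ih (hS.pow k).monotone hT

variable (G β)

/-- The update of the spin at `v` with probability `α`. -/
def lazyUpdate (v : V) (α : ℝ) : Module.End ℝ ((V → Bool) → ℝ) :=
  α • blockAvg G β {v} + (1 - α) • 1

theorem lazyUpdate_apply (v : V) (α : ℝ) (f : (V → Bool) → ℝ) :
    lazyUpdate G β v α f = α • blockAvg G β {v} f + (1 - α) • f := rfl

theorem pairing_lazyUpdate (v : V) (α : ℝ) (f g : (V → Bool) → ℝ) :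
    pairing G β (lazyUpdate G β v α f) g =
      α * pairing G β (blockAvg G β {v} f) g + (1 - α) * pairing G β f g := by
  rw [lazyUpdate_apply, pairing_add_left, pairing_smul_left, pairing_smul_left]

theorem lazyUpdate_mul (v : V) (α α' : ℝ) :
    lazyUpdate G β v α * lazyUpdate G β v α' = lazyUpdate G β v (1 - (1 - α) * (1 - α')) := by
  refine LinearMap.ext fun f => ?_
  rw [Module.End.mul_apply, lazyUpdate_apply, lazyUpdate_apply, lazyUpdate_apply, map_add,
    map_smul, map_smul, blockAvg_blockAvg_of_subset_right G β subset_rfl]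
  ext σ
  simp only [Pi.add_apply, Pi.smul_apply, smul_eq_mul]
  ring

theorem lazyUpdate_pow (v : V) (α : ℝ) (k : ℕ) :
    lazyUpdate G β v α ^ k = lazyUpdate G β v (1 - (1 - α) ^ k) := by
  induction k with
  | zero => exact LinearMap.ext fun f => by simp [lazyUpdate_apply]
  | succ k ih =>
    rw [pow_succ, ih, lazyUpdate_mul]
    congr 1
    ring

variable {β}

theorem isMonotoneReversible_lazyUpdate (hβ : 0 ≤ β) (v : V) {α : ℝ} (h0 : 0 ≤ α) (h1 : α ≤ 1) :
    IsMonotoneReversible G β (lazyUpdate G β v α) := by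
  refine ⟨fun f hf σ τ hst => ?_, fun f g => ?_⟩
  · have h2 := monotone_blockAvg G hβ {v} hf hst
    have h3 := hf hst
    simp only [lazyUpdate_apply, Pi.add_apply, Pi.smul_apply, smul_eq_mul]
    have := sub_nonneg.2 h1
    gcongr
  · rw [pairing_lazyUpdate, pairing_comm G β f (lazyUpdate G β v α g), pairing_lazyUpdate,
      pairing_blockAvg, pairing_comm G β f (blockAvg G β {v} g), pairing_comm G β f g]

theorem comparisonLE_lazyUpdate (hβ : 0 ≤ β) (v : V) {α α' : ℝ} (h : α ≤ α') :
    ComparisonLE G β (lazyUpdate G β v α') (lazyUpdate G β v α) := by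
  intro f g hf hg
  rw [pairing_lazyUpdate, pairing_lazyUpdate]
  nlinarith [pairing_blockAvg_le G hβ {v} hf hg]

end Comparison

/-! ### Block dynamics against sweeps; convergence of sweeps -/

section Dynamics

variable {V : Type*} [Fintype V] [DecidableEq V]
variable (G : SimpleGraph V) [DecidableRel G.Adj] (β : ℝ)

/-- The block dynamics as an operator on functions. -/
def dynamicsOp {r : ℕ} (B : Fin r → Finset V) : Module.End ℝ ((V → Bool) → ℝ) :=
  (blockDynamics G β B).mulVecLin

theorem dynamicsOp_apply {r : ℕ} (B : Fin r → Finset V) (f : (V → Bool) → ℝ) :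
    dynamicsOp G β B f = (r : ℝ)⁻¹ • ∑ i, blockAvg G β (B i) f := by
  rw [dynamicsOp, blockDynamics, Matrix.mulVecLin_apply, Matrix.smul_mulVec, Matrix.sum_mulVec]
  rfl

theorem pairing_dynamicsOp {r : ℕ} (B : Fin r → Finset V) (f g : (V → Bool) → ℝ) :
    pairing G β (dynamicsOp G β B f) g =
      (r : ℝ)⁻¹ * ∑ i, pairing G β (blockAvg G β (B i) f) g := by
  rw [dynamicsOp_apply, pairing_smul_left]
  congr 1
  simp only [pairing, Finset.sum_apply, Finset.sum_mul, Finset.mul_sum]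
  exact Finset.sum_comm

theorem dynamicsOp_one {r : ℕ} (hr : 0 < r) (B : Fin r → Finset V) :
    dynamicsOp G β B 1 = 1 := by
  have : (r : ℝ) ≠ 0 := by positivity
  rw [dynamicsOp_apply]
  ext σ
  simp [blockAvg_one, this]

variable {β}

theorem isMonotoneReversible_dynamicsOp (hβ : 0 ≤ β) {r : ℕ} (B : Fin r → Finset V) :
    IsMonotoneReversible G β (dynamicsOp G β B) := by
  refine ⟨fun f hf σ τ hst => ?_, fun f g => ?_⟩
  · rw [dynamicsOp_apply]
    simp only [Pi.smul_apply, Finset.sum_apply, smul_eq_mul]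
    exact mul_le_mul_of_nonneg_left
      (Finset.sum_le_sum fun i _ => monotone_blockAvg G hβ (B i) hf hst) (by positivity)
  · rw [pairing_dynamicsOp, pairing_comm G β f (dynamicsOp G β B g), pairing_dynamicsOp]
    congr 1
    exact Finset.sum_congr rfl fun i _ => by rw [pairing_blockAvg, pairing_comm]

/-- The block containing `v` is compared with {v}, the other r - 1 blocks with the identity. -/
theorem dynamicsOp_comparisonLE_lazyUpdate (hβ : 0 ≤ β) {r : ℕ} (B : Fin r → Finset V) {v : V}
    {i : Fin r} (hv : v ∈ B i) :
    ComparisonLE G β (dynamicsOp G β B) (lazyUpdate G β v (r : ℝ)⁻¹) := by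
  intro f g hf hg
  have hr : (0 : ℝ) < r := by exact_mod_cast i.pos
  rw [pairing_dynamicsOp, pairing_lazyUpdate, ← Finset.add_sum_erase _ _ (Finset.mem_univ i)]
  have h1 := pairing_blockAvg_le_of_subset G hβ (Finset.singleton_subset_iff.2 hv) hf hg
  have h2 : ∑ j ∈ Finset.univ.erase i, pairing G β (blockAvg G β (B j) f) g ≤
      (r - 1) * pairing G β f g := by
    refine (Finset.sum_le_card_nsmul _ _ _ fun j _ => pairing_blockAvg_le G hβ (B j) hf hg).trans
      (le_of_eq ?_)
    rw [Finset.card_erase_of_mem (Finset.mem_univ i), Finset.card_univ, Fintype.card_fin,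
      nsmul_eq_mul, Nat.cast_pred i.pos]
  have h3 : (1 - (r : ℝ)⁻¹) * pairing G β f g =
      (r : ℝ)⁻¹ * ((r - 1) * pairing G β f g) := by
    field_simp
  rw [h3, ← mul_add]
  exact mul_le_mul_of_nonneg_left (add_le_add h1 h2) (by positivity)

/-- After `r` steps the block dynamics has mixed at least as much as an update of any single spin
with probability `1 / 2`. -/
theorem dynamicsOp_pow_comparisonLE_lazyUpdate (hβ : 0 ≤ β) {r : ℕ} (B : Fin r → Finset V)
    (hB : ∀ v, ∃ i, v ∈ B i) (v : V) :
    ComparisonLE G β (dynamicsOp G β B ^ r) (lazyUpdate G β v (1 / 2)) := by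
  obtain ⟨i, hi⟩ := hB v
  have hr : (1 : ℝ) ≤ r := by exact_mod_cast i.pos
  have hr1 : (r : ℝ)⁻¹ ≤ 1 := inv_le_one_of_one_le₀ hr
  have h := (dynamicsOp_comparisonLE_lazyUpdate G hβ B hi).pow
    (isMonotoneReversible_dynamicsOp G hβ B)
    (isMonotoneReversible_lazyUpdate G hβ v (by positivity) hr1) r
  rw [lazyUpdate_pow] at h
  refine h.trans (comparisonLE_lazyUpdate G hβ v ?_)
  -- In r trials of probability 1/r no update occurs with probability at most 1/e ≤ 1/2.
  have h1 := Real.one_sub_div_pow_le_exp_neg hr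
  have h2 : Real.exp (-1) ≤ 1 / 2 := by
    rw [Real.exp_neg, one_div]
    exact inv_anti₀ two_pos (by linarith [Real.add_one_le_exp (1 : ℝ)])
  rw [one_div (r : ℝ)] at h1
  linarith

variable (β)

/-- The composition of the updates, with probability `1 / 2` each, of the spins in a list. -/
def sweep (l : List V) : Module.End ℝ ((V → Bool) → ℝ) :=
  (l.map fun v => lazyUpdate G β v (1 / 2)).prod

theorem sweep_nil : sweep G β ([] : List V) = 1 := rfl

theorem sweep_cons (v : V) (l : List V) :
    sweep G β (v :: l) = lazyUpdate G β v (1 / 2) * sweep G β l := by simp [sweep]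

theorem sweep_append (l l' : List V) :
    sweep G β (l ++ l') = sweep G β l * sweep G β l' := by simp [sweep]

theorem sweep_flatten_replicate (l : List V) (m : ℕ) :
    sweep G β (List.replicate m l).flatten = sweep G β l ^ m := by
  induction m with
  | zero => rfl
  | succ m ih => rw [List.replicate_succ, List.flatten_cons, sweep_append, ih, pow_succ']

variable {β}

theorem dynamicsOp_pow_comparisonLE_sweep (hβ : 0 ≤ β) {r : ℕ} (B : Fin r → Finset V)
    (hB : ∀ v, ∃ i, v ∈ B i) (l : List V) :
    ComparisonLE G β (dynamicsOp G β B ^ (r * l.length)) (sweep G β l) := by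
  induction l with
  | nil => exact fun f g _ _ => le_rfl
  | cons v l ih =>
    rw [List.length_cons, mul_add, mul_one, add_comm, pow_add, sweep_cons]
    exact (dynamicsOp_pow_comparisonLE_lazyUpdate G hβ B hB v).mul ih
      ((isMonotoneReversible_dynamicsOp G hβ B).pow _).monotone
      (isMonotoneReversible_lazyUpdate G hβ v (by norm_num) (by norm_num))

variable (β)

theorem lazyUpdate_half_apply (v : V) (f : (V → Bool) → ℝ) (σ : V → Bool) :
    lazyUpdate G β v (1 / 2) f σ = (blockAvg G β {v} f σ + f σ) / 2 := by
  rw [lazyUpdate_apply]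
  simp only [Pi.add_apply, Pi.smul_apply, smul_eq_mul]
  ring

theorem sweep_nonneg (l : List V) {f : (V → Bool) → ℝ} (hf : 0 ≤ f) : 0 ≤ sweep G β l f := by
  induction l with
  | nil => exact hf
  | cons v l ih =>
    intro σ
    rw [sweep_cons, Module.End.mul_apply, lazyUpdate_half_apply]
    have h1 := blockAvg_nonneg G β {v} ih σ
    have h2 := ih σ
    rw [Pi.zero_apply] at *
    positivity

theorem sweep_blockAvg {A : Finset V} (l : List V) (hl : ∀ v ∈ l, v ∈ A) (f : (V → Bool) → ℝ) :
    sweep G β l (blockAvg G β A f) = blockAvg G β A f := by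
  induction l with
  | nil => rfl
  | cons v l ih =>
    ext σ
    rw [sweep_cons, Module.End.mul_apply, ih fun w hw => hl w (List.mem_cons_of_mem _ hw),
      lazyUpdate_half_apply, blockAvg_blockAvg_of_subset_right G β
        (Finset.singleton_subset_iff.2 (hl v List.mem_cons_self))]
    ring

theorem blockAvg_sweep {A : Finset V} (l : List V) (hl : ∀ v ∈ l, v ∈ A) (f : (V → Bool) → ℝ) :
    blockAvg G β A (sweep G β l f) = blockAvg G β A f := by
  induction l with
  | nil => rfl
  | cons v l ih =>
    rw [sweep_cons, Module.End.mul_apply, lazyUpdate_apply, map_add, map_smul, map_smul,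
      blockAvg_blockAvg_of_subset_left G β
        (Finset.singleton_subset_iff.2 (hl v List.mem_cons_self)),
      ih fun w hw => hl w (List.mem_cons_of_mem _ hw), ← add_smul]
    norm_num

theorem sweep_one (l : List V) : sweep G β l 1 = 1 := by
  induction l with
  | nil => rfl
  | cons v l ih =>
    rw [sweep_cons, Module.End.mul_apply, ih, lazyUpdate_apply, blockAvg_one, ← add_smul]
    norm_num

theorem sweep_update_eq {u : V} (l : List V) (hu : u ∉ l) (hl : ∀ w ∈ l, ¬ G.Adj u w)
    {f : (V → Bool) → ℝ}
    (hf : ∀ σ, f (Function.update σ u true) = f (Function.update σ u false)) (σ : V → Bool) :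
    sweep G β l f (Function.update σ u true) = sweep G β l f (Function.update σ u false) := by
  induction l generalizing σ with
  | nil => exact hf σ
  | cons v l ih =>
    have ih' := ih (fun h => hu (List.mem_cons_of_mem _ h))
      fun w hw => hl w (List.mem_cons_of_mem _ hw)
    rw [sweep_cons, Module.End.mul_apply, lazyUpdate_half_apply, lazyUpdate_half_apply, ih',
      blockAvg_update_eq G β (fun h => hu ?_) (fun w hw => ?_) ih']
    · rw [Finset.mem_singleton] at h
      subst h
      exact List.mem_cons_self
    · rw [Finset.mem_singleton] at hw
      subst hw
      exact hl w List.mem_cons_self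

variable {β}

/-- Each listed vertex is updated with probability 1/2 and then takes its value in τ with
conditional probability at least 1 / (1 + exp (2βD)). -/
theorem le_sweep (hβ : 0 ≤ β) {D : ℕ} (hD : ∀ v, G.degree v ≤ D) (l : List V)
    {f : (V → Bool) → ℝ} (hf : 0 ≤ f) (σ τ : V → Bool) (h : AgreeOff l.toFinset σ τ) :
    ((1 + Real.exp (2 * β * D))⁻¹ / 2) ^ l.length * f τ ≤ sweep G β l f σ := by
  induction l generalizing σ with
  | nil =>
    have : τ = σ := funext fun v => h v (by simp)
    simp [sweep_nil, this]
  | cons v l ih =>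
    have hag : AgreeOff l.toFinset (Function.update σ v (τ v)) τ := by
      intro w hw
      by_cases hwv : w = v
      · subst hwv; simp
      · rw [Function.update_of_ne hwv]
        exact h w (by simpa [hwv] using hw)
    have h1 := ih _ hag
    have hg := sweep_nonneg G β l hf
    have h2 := le_blockAvg_singleton G hβ hD v hg σ (τ v)
    have h3 := hg σ
    rw [Pi.zero_apply] at h3
    rw [sweep_cons, Module.End.mul_apply, lazyUpdate_half_apply, List.length_cons, pow_succ']
    have hp : 0 < (1 + Real.exp (2 * β * D))⁻¹ := by positivity
    have h4 := mul_le_mul_of_nonneg_left h1 hp.le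
    rw [mul_assoc, div_mul_eq_mul_div]
    linarith

theorem blockAvg_le_sweep (hβ : 0 ≤ β) {D : ℕ} (hD : ∀ v, G.degree v ≤ D) (l : List V)
    {f : (V → Bool) → ℝ} (hf : 0 ≤ f) (σ : V → Bool) :
    ((1 + Real.exp (2 * β * D))⁻¹ / 2) ^ l.length * blockAvg G β l.toFinset f σ ≤
      sweep G β l f σ := by
  rw [blockAvg_apply, mul_div_assoc', div_le_iff₀ (fiberSum_one_pos ..), fiberSum, fiberSum,
    Finset.mul_sum, Finset.mul_sum]
  refine Finset.sum_le_sum fun τ hτ => ?_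
  have := mul_le_mul_of_nonneg_left (le_sweep G hβ hD l hf σ τ (Finset.mem_filter.1 hτ).2)
    (isingWeight_pos G β τ).le
  rw [Pi.one_apply, mul_one]
  linarith

/-- Doeblin's argument: the sweep dominates η times the block average. Applied to the nonnegative
functions (current bound) ± g with g of zero block average, this gains a factor 1 - η. -/
theorem abs_sweep_pow_le (hβ : 0 ≤ β) {D : ℕ} (hD : ∀ v, G.degree v ≤ D) (l : List V)
    {f : (V → Bool) → ℝ} {c : ℝ} (hf : ∀ σ, |f σ| ≤ c) (hf0 : blockAvg G β l.toFinset f = 0)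
    (m : ℕ) (σ : V → Bool) :
    |(sweep G β l ^ m) f σ| ≤
      (1 - ((1 + Real.exp (2 * β * D))⁻¹ / 2) ^ l.length) ^ m * c := by
  set η := ((1 + Real.exp (2 * β * D))⁻¹ / 2) ^ l.length
  have key : blockAvg G β l.toFinset ((sweep G β l ^ m) f) = 0 ∧
      ∀ σ, |(sweep G β l ^ m) f σ| ≤ (1 - η) ^ m * c := by
    induction m with
    | zero => exact ⟨hf0, by simpa using hf⟩
    | succ m ih =>
      obtain ⟨ih0, ih1⟩ := ih
      rw [pow_succ', Module.End.mul_apply]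
      set g := (sweep G β l ^ m) f
      refine ⟨by rw [blockAvg_sweep G β l (fun v hv => by simpa using hv), ih0], fun σ => ?_⟩
      have h1 := blockAvg_le_sweep G hβ hD l (f := ((1 - η) ^ m * c) • 1 - g)
        (fun σ => by simpa using (abs_le.1 (ih1 σ)).2) σ
      have h2 := blockAvg_le_sweep G hβ hD l (f := ((1 - η) ^ m * c) • 1 + g)
        (fun σ => by
          have := (abs_le.1 (ih1 σ)).1
          simp only [Pi.zero_apply, Pi.add_apply, Pi.smul_apply, Pi.one_apply, smul_eq_mul,
            mul_one]
          linarith) σ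
      rw [map_sub, map_smul, map_sub, map_smul, blockAvg_one, sweep_one, ih0] at h1
      rw [map_add, map_smul, map_add, map_smul, blockAvg_one, sweep_one, ih0] at h2
      simp only [Pi.zero_apply, Pi.add_apply, Pi.sub_apply, Pi.smul_apply, Pi.one_apply,
        smul_eq_mul, mul_one, sub_zero, add_zero] at h1 h2
      rw [abs_le, pow_succ]
      constructor <;> linarith
  exact key.2 σ

theorem abs_blockAvg_le (A : Finset V) {f : (V → Bool) → ℝ} {c : ℝ} (hf : ∀ σ, |f σ| ≤ c)
    (σ : V → Bool) : |blockAvg G β A f σ| ≤ c := by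
  have h1 := blockAvg_nonneg G β A (f := c • 1 - f)
    (fun σ => by simpa using (abs_le.1 (hf σ)).2) σ
  have h2 := blockAvg_nonneg G β A (f := c • 1 + f)
    (fun σ => by
      have := (abs_le.1 (hf σ)).1
      simp only [Pi.zero_apply, Pi.add_apply, Pi.smul_apply, Pi.one_apply, smul_eq_mul, mul_one]
      linarith) σ
  rw [map_sub, map_smul, blockAvg_one] at h1
  rw [map_add, map_smul, blockAvg_one] at h2
  simp only [Pi.zero_apply, Pi.add_apply, Pi.sub_apply, Pi.smul_apply, Pi.one_apply,
    smul_eq_mul, mul_one] at h1 h2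
  rw [abs_le]
  constructor <;> linarith

/-- Repeated sweeps of a block converge to the heat-bath update of the block. -/
theorem abs_sweep_pow_sub_blockAvg_le (hβ : 0 ≤ β) {D : ℕ} (hD : ∀ v, G.degree v ≤ D)
    (l : List V) {f : (V → Bool) → ℝ} (hf : ∀ σ, |f σ| ≤ 1) (m : ℕ) (σ : V → Bool) :
    |(sweep G β l ^ m) f σ - blockAvg G β l.toFinset f σ| ≤
      (1 - ((1 + Real.exp (2 * β * D))⁻¹ / 2) ^ l.length) ^ m * 2 := by
  have h0 : blockAvg G β l.toFinset (f - blockAvg G β l.toFinset f) = 0 := by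
    rw [map_sub, blockAvg_blockAvg_of_subset_right G β subset_rfl, sub_self]
  have h1 : ∀ σ, |(f - blockAvg G β l.toFinset f) σ| ≤ 2 := by
    intro σ
    have h2 := abs_blockAvg_le G (β := β) l.toFinset hf σ
    have h3 := hf σ
    rw [abs_le] at h2 h3 ⊢
    rw [Pi.sub_apply]
    constructor <;> linarith [h2.1, h2.2, h3.1, h3.2]
  have h2 := abs_sweep_pow_le G hβ hD l h1 h0 m σ
  have h3 : ∀ m, (sweep G β l ^ m) (blockAvg G β l.toFinset f) = blockAvg G β l.toFinset f := by
    intro m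
    induction m with
    | zero => rfl
    | succ m ih =>
      rw [pow_succ, Module.End.mul_apply, sweep_blockAvg G β l (fun v hv => by simpa using hv), ih]
  rwa [map_sub, h3, Pi.sub_apply] at h2

end Dynamics

/-! ### Contraction of the magnetization gap -/

section Contraction

variable {V : Type*} [Fintype V] [DecidableEq V]

theorem monotone_spin (u : V) : Monotone fun σ : V → Bool => spin (σ u) := by
  have hmono : Monotone spin := by
    intro a b h
    cases a <;> cases b
    · exact le_rfl
    · norm_num [spin]
    · exact absurd (h rfl) (by simp)
    · exact le_rfl
  exact fun σ τ h => hmono (h u)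

theorem monotone_sum_smul_spin {c : V → ℝ} (hc : ∀ u, 0 ≤ c u) :
    Monotone (∑ u, c u • fun σ : V → Bool => spin (σ u)) := by
  intro σ τ h
  simp only [Finset.sum_apply, Pi.smul_apply, smul_eq_mul]
  exact Finset.sum_le_sum fun u _ => mul_le_mul_of_nonneg_left (monotone_spin u h) (hc u)

theorem sum_smul_spin_update_sub (c : V → ℝ) (σ : V → Bool) (u : V) :
    (∑ w, c w • fun σ : V → Bool => spin (σ w)) (Function.update σ u true) -
      (∑ w, c w • fun σ : V → Bool => spin (σ w)) (Function.update σ u false) = 2 * c u := by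
  simp only [Finset.sum_apply, Pi.smul_apply, smul_eq_mul]
  rw [← Finset.sum_sub_distrib, Finset.sum_eq_single u]
  · simp [spin]
    ring
  · intro w _ hw
    simp [hw]
  · simp

theorem monotone_sum_smul_spin_sub {c : V → ℝ} {f : (V → Bool) → ℝ}
    (hf : ∀ σ u, |f (Function.update σ u true) - f (Function.update σ u false)| ≤ 2 * c u) :
    Monotone ((∑ u, c u • fun σ : V → Bool => spin (σ u)) - f) := by
  refine monotone_of_update_le fun σ u => ?_
  have h1 := sum_smul_spin_update_sub c σ u
  have h2 := (abs_le.1 (hf σ u)).2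
  simp only [Pi.sub_apply]
  linarith

theorem monotone_sum_smul_spin_add {c : V → ℝ} {f : (V → Bool) → ℝ}
    (hf : ∀ σ u, |f (Function.update σ u true) - f (Function.update σ u false)| ≤ 2 * c u) :
    Monotone ((∑ u, c u • fun σ : V → Bool => spin (σ u)) + f) := by
  have := monotone_sum_smul_spin_sub (c := c) (f := -f) fun σ u => by
    rw [Pi.neg_apply, Pi.neg_apply, neg_sub_neg, abs_sub_comm]
    exact hf σ u
  rwa [sub_neg_eq_add] at this

/-- Padding with copies of `v` makes the length, and so the number of steps, the same for all balls.
-/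
theorem exists_list_of_card_le {s : Finset V} {v : V} (hv : v ∈ s) {K : ℕ} (hK : s.card ≤ K) :
    ∃ l : List V, l.length = K ∧ l.toFinset = s := by
  refine ⟨s.toList ++ List.replicate (K - s.card) v, by simp [hK], ?_⟩
  ext w
  simp only [List.mem_toFinset, List.mem_append, Finset.mem_toList, List.mem_replicate]
  exact ⟨fun h => h.elim id fun h => h.2 ▸ hv, Or.inl⟩

variable (G : SimpleGraph V) [DecidableRel G.Adj] {β : ℝ}

/-- The point mass at ⊤ is an increasing test function, and `U` moves onto it by self-adjointness.
-/
theorem ComparisonLE.apply_top_le {S T U : Module.End ℝ ((V → Bool) → ℝ)}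
    (h : ComparisonLE G β S T) (hU : IsMonotoneReversible G β U) {f : (V → Bool) → ℝ}
    (hf : Monotone f) : U (S f) ⊤ ≤ U (T f) ⊤ := by
  have hm : Monotone (Pi.single (⊤ : V → Bool) (1 : ℝ) : (V → Bool) → ℝ) := by
    intro σ τ hst
    by_cases hσ : σ = ⊤
    · rw [hσ] at hst ⊢
      rw [top_le_iff.1 hst]
    · rw [Pi.single_eq_of_ne hσ]
      exact (Pi.single_nonneg.2 zero_le_one : (0 : (V → Bool) → ℝ) ≤ Pi.single ⊤ 1) τ
  have := h f _ hf (hU.monotone _ hm)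
  rw [← hU.symm, ← hU.symm, pairing_single, pairing_single] at this
  exact le_of_mul_le_mul_left this (isingWeight_pos G β _)

theorem ComparisonLE.le_apply_bot {S T U : Module.End ℝ ((V → Bool) → ℝ)}
    (h : ComparisonLE G β S T) (hU : IsMonotoneReversible G β U) {f : (V → Bool) → ℝ}
    (hf : Monotone f) : U (T f) ⊥ ≤ U (S f) ⊥ := by
  have hm : Monotone (-(Pi.single (⊥ : V → Bool) (1 : ℝ) : (V → Bool) → ℝ)) := by
    intro σ τ hst
    rw [Pi.neg_apply, Pi.neg_apply, neg_le_neg_iff]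
    by_cases hτ : τ = ⊥
    · rw [hτ] at hst ⊢
      rw [le_bot_iff.1 hst]
    · rw [Pi.single_eq_of_ne hτ]
      exact (Pi.single_nonneg.2 zero_le_one : (0 : (V → Bool) → ℝ) ≤ Pi.single ⊥ 1) σ
  have := h f _ hf (hU.monotone _ hm)
  rw [← hU.symm, ← hU.symm, ← neg_one_smul ℝ, pairing_smul_right, pairing_smul_right,
    pairing_single, pairing_single] at this
  exact le_of_mul_le_mul_left (by linarith) (isingWeight_pos G β _)

/-- The heat-bath update of a large ball contracts the influence of the spins on the centre, and
this persists if the update is approximated by repeated sweeps. -/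
theorem abs_sweep_pow_spin_update_sub_le (hβ : 0 ≤ β) {q : ℕ} (hdeg : ∀ v, G.degree v ≤ q + 1)
    {k K : ℕ} {v : V} {l : List V} (hlen : l.length = K)
    (hl : l.toFinset = ball G (k + 2) v) {b : V → ℝ} (hb0 : ∀ u, 0 ≤ b u)
    (hb : ∀ u ∉ ball G (k + 2) v, ∀ σ,
      |halfLogOdds G β (ball G (k + 2) v) v (Function.update σ u true) 0 -
        halfLogOdds G β (ball G (k + 2) v) v (Function.update σ u false) 0| ≤ b u)
    (m : ℕ) {ε : ℝ}
    (hε : (1 - ((1 + Real.exp (2 * β * (q + 1)))⁻¹ / 2) ^ K) ^ m * 2 ≤ ε) (σ : V → Bool) (u : V) :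
    |(sweep G β l ^ m) (fun τ => spin (τ v)) (Function.update σ u true) -
      (sweep G β l ^ m) (fun τ => spin (τ v)) (Function.update σ u false)| ≤
      2 * ((if u ∉ ball G (k + 2) v then b u / 2 else 0) +
        if u ∈ ball G (k + 3) v then ε else 0) := by
  have hv : v ∈ ball G (k + 2) v := mem_ball_succ_self G _ v
  by_cases hu3 : u ∈ ball G (k + 3) v
  · have happ : ∀ σ, |(sweep G β l ^ m) (fun τ => spin (τ v)) σ -
        blockAvg G β (ball G (k + 2) v) (fun τ => spin (τ v)) σ| ≤ ε := by
      intro σ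
      have := abs_sweep_pow_sub_blockAvg_le G hβ hdeg l (f := fun τ => spin (τ v))
        (fun τ => (abs_spin _).le) m σ
      rw [hl, hlen] at this
      push_cast at this
      exact this.trans hε
    have hbd : |blockAvg G β (ball G (k + 2) v) (fun τ => spin (τ v)) (Function.update σ u true) -
        blockAvg G β (ball G (k + 2) v) (fun τ => spin (τ v)) (Function.update σ u false)| ≤
        if u ∉ ball G (k + 2) v then b u else 0 := by
      split_ifs with hu2
      · rw [← blockAvg_congr G β (agreeOff_update hu2 σ true),
          ← blockAvg_congr G β (agreeOff_update hu2 σ false), sub_self, abs_zero]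
      · rw [blockAvg_spin G β hv, blockAvg_spin G β hv]
        exact (abs_tanh_sub_le _ _).trans (hb u hu2 σ)
    have h1 := abs_le.1 (happ (Function.update σ u true))
    have h2 := abs_le.1 (happ (Function.update σ u false))
    have h3 := abs_le.1 hbd
    have h4 : 2 * (if u ∉ ball G (k + 2) v then b u / 2 else 0) =
        if u ∉ ball G (k + 2) v then b u else 0 := by split_ifs <;> ring
    rw [if_pos hu3, mul_add, h4, abs_le]
    constructor <;> linarith [h1.1, h1.2, h2.1, h2.2, h3.1, h3.2]
  -- No updated vertex is adjacent to `u`, so the dependence on `u` is exactly zero. The error ε is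
  -- therefore paid at boundedly many vertices rather than at all n.
  · have hu2 : u ∉ ball G (k + 2) v := fun h => hu3 (ball_subset_ball_succ G _ v h)
    have hul : u ∉ l := fun h => hu2 (hl ▸ List.mem_toFinset.2 h)
    have hadj : ∀ w ∈ l, ¬ G.Adj u w := fun w hw h =>
      hu3 (mem_ball_succ_of_adj G h.symm _ (hl ▸ List.mem_toFinset.2 hw))
    have huv : v ≠ u := by rintro rfl; exact hu2 hv
    have hz : ∀ m σ, (sweep G β l ^ m) (fun τ => spin (τ v)) (Function.update σ u true) =
        (sweep G β l ^ m) (fun τ => spin (τ v)) (Function.update σ u false) := by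
      intro m
      induction m with
      | zero => intro σ; simp [huv]
      | succ m ih =>
        intro σ
        rw [pow_succ', Module.End.mul_apply]
        exact sweep_update_eq G β l hul hadj ih σ
    rw [hz m σ, sub_self, abs_zero]
    have := hb0 u
    split_ifs
    positivity

variable (β)

/-- The difference of the expectations of `f` at time `t`, started from all `+` and all `-`. -/
def extremalGap {r : ℕ} (B : Fin r → Finset V) (t : ℕ) (f : (V → Bool) → ℝ) : ℝ :=
  (dynamicsOp G β B ^ t) f ⊤ - (dynamicsOp G β B ^ t) f ⊥

theorem extremalGap_sub {r : ℕ} (B : Fin r → Finset V) (t : ℕ) (f g : (V → Bool) → ℝ) :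
    extremalGap G β B t (f - g) = extremalGap G β B t f - extremalGap G β B t g := by
  simp only [extremalGap, map_sub, Pi.sub_apply]
  ring

theorem extremalGap_sum_smul {r : ℕ} (B : Fin r → Finset V) (t : ℕ) (c : V → ℝ) :
    extremalGap G β B t (∑ u, c u • fun σ : V → Bool => spin (σ u)) =
      ∑ u, c u * extremalGap G β B t fun σ => spin (σ u) := by
  simp only [extremalGap, map_sum, map_smul, Finset.sum_apply, Pi.smul_apply, smul_eq_mul,
    mul_sub, Finset.sum_sub_distrib]

variable {β}

theorem extremalGap_nonneg (hβ : 0 ≤ β) {r : ℕ} (B : Fin r → Finset V) (t : ℕ)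
    {f : (V → Bool) → ℝ} (hf : Monotone f) : 0 ≤ extremalGap G β B t f :=
  sub_nonneg.2 (((isMonotoneReversible_dynamicsOp G hβ B).pow t).monotone f hf bot_le)

/-- The linear combination of spins minus f is increasing, so its gap is nonnegative. -/
theorem extremalGap_le_sum (hβ : 0 ≤ β) {r : ℕ} (B : Fin r → Finset V) (t : ℕ)
    {f : (V → Bool) → ℝ} {c : V → ℝ}
    (hf : ∀ σ u, |f (Function.update σ u true) - f (Function.update σ u false)| ≤ 2 * c u) :
    extremalGap G β B t f ≤ ∑ u, c u * extremalGap G β B t fun σ => spin (σ u) := by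
  have := extremalGap_nonneg G hβ B t (monotone_sum_smul_spin_sub hf)
  rw [extremalGap_sub, extremalGap_sum_smul] at this
  linarith

theorem extremalGap_add_le_sweep (hβ : 0 ≤ β) {r : ℕ} (B : Fin r → Finset V)
    (hB : ∀ v, ∃ i, v ∈ B i) (t : ℕ) (l : List V) (m : ℕ) {f : (V → Bool) → ℝ} (hf : Monotone f) :
    extremalGap G β B (t + r * (m * l.length)) f ≤ extremalGap G β B t ((sweep G β l ^ m) f) := by
  have h := dynamicsOp_pow_comparisonLE_sweep G hβ B hB (List.replicate m l).flatten
  rw [sweep_flatten_replicate] at h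
  have hlen : (List.replicate m l).flatten.length = m * l.length := by simp
  rw [hlen] at h
  have hU := (isMonotoneReversible_dynamicsOp G hβ B).pow t
  have h1 := h.apply_top_le G hU hf
  have h2 := h.le_apply_bot G hU hf
  rw [extremalGap, extremalGap, pow_add, Module.End.mul_apply]
  linarith

end Contraction

/-- Below the critical temperature the magnetization gap halves every `N r` steps, with `N`
depending only on the degree and the temperature. -/
theorem exists_extremalGap_le_half {β : ℝ} (hβ : 0 < β) {q : ℕ} (hq : q * Real.tanh β < 1) :
    ∃ N : ℕ, 0 < N ∧ ∀ (V : Type*) [Fintype V] [DecidableEq V] (G : SimpleGraph V)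
      [DecidableRel G.Adj], (∀ v, G.degree v ≤ q + 1) →
      ∀ (r : ℕ) (B : Fin r → Finset V), (∀ v, ∃ i, v ∈ B i) →
      ∀ (t : ℕ) (c : ℝ), (∀ u, extremalGap G β B t (fun σ => spin (σ u)) ≤ c) →
      ∀ v, extremalGap G β B (t + r * N) (fun σ => spin (σ v)) ≤ c / 2 := by
  have ht := tanh_nonneg hβ.le
  have hθ : 0 ≤ q * Real.tanh β := by positivity
  obtain ⟨C, hC, hCeq⟩ : ∃ C : ℝ, 0 ≤ C ∧ 1 + q * Real.tanh β * C = C := by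
    have hpos : 0 < 1 - q * Real.tanh β := sub_pos.2 hq
    refine ⟨(1 - q * Real.tanh β)⁻¹, (inv_pos.2 hpos).le, ?_⟩
    field_simp
    ring
  -- The radius makes the total boundary influence at most 1/2, which enters the gap with a factor
  -- 1/2; the number of sweeps chosen below leaves 1/4 for the approximation error.
  obtain ⟨k, hk⟩ : ∃ k : ℕ, 2 * β * (q + 1) ^ 2 * C * (q * Real.tanh β) ^ k ≤ 1 / 2 := by
    have := ((tendsto_pow_atTop_nhds_zero_of_lt_one hθ hq).const_mul
      (2 * β * (q + 1) ^ 2 * C)).eventually_le_const (u := 1 / 2) (by simp)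
    exact this.exists
  set K := (q + 1 + 1) ^ (k + 2) with hK
  have hKpos : 0 < K := by positivity
  set η := ((1 + Real.exp (2 * β * (q + 1)))⁻¹ / 2) ^ K with hη
  have hbase : (1 + Real.exp (2 * β * (q + 1)))⁻¹ / 2 ≤ 1 := by
    have : (1 + Real.exp (2 * β * (q + 1)))⁻¹ ≤ 1 :=
      inv_le_one_of_one_le₀ (by linarith [Real.exp_pos (2 * β * (q + 1))])
    linarith
  have hη0 : 0 < η := by positivity
  have hη1 : η ≤ 1 := pow_le_one₀ (by positivity) hbase
  obtain ⟨m, hm⟩ : ∃ m : ℕ, ((q + 1 + 1 : ℕ) : ℝ) ^ (k + 3) * ((1 - η) ^ m * 2) ≤ 1 / 4 := by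
    have h := ((tendsto_pow_atTop_nhds_zero_of_lt_one (sub_nonneg.2 hη1)
      (by linarith : 1 - η < 1)).mul_const 2).const_mul (((q + 1 + 1 : ℕ) : ℝ) ^ (k + 3))
    exact (h.eventually_le_const (u := 1 / 4) (by simp)).exists
  -- The spare sweep keeps N positive.
  refine ⟨(m + 1) * K, by positivity, ?_⟩
  intro V _ _ G _ hdeg r B hB t c hc v
  obtain ⟨l, hlen, hl⟩ := exists_list_of_card_le (mem_ball_succ_self G (k + 1) v)
    (card_ball_le G hdeg (k + 2) v)
  obtain ⟨b, hb0, hb, hbsum⟩ := exists_boundary_influence G hβ.le hdeg hC hCeq k v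
  set ε := (1 - η) ^ m * 2 with hε
  have hε0 : 0 ≤ ε := mul_nonneg (pow_nonneg (sub_nonneg.2 hη1) _) zero_le_two
  have hεm : (1 - η) ^ (m + 1) * 2 ≤ ε := by
    have : (1 - η) ^ (m + 1) ≤ (1 - η) ^ m :=
      pow_le_pow_of_le_one (sub_nonneg.2 hη1) (by linarith) (Nat.le_succ m)
    exact mul_le_mul_of_nonneg_right this zero_le_two
  have h1 := extremalGap_add_le_sweep G hβ.le B hB t l (m + 1) (monotone_spin v)
  rw [hlen] at h1
  have h2 := extremalGap_le_sum G hβ.le B t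
    (abs_sweep_pow_spin_update_sub_le G hβ.le hdeg hlen hl hb0 hb (m + 1) hεm)
  have hc0 : 0 ≤ c := (extremalGap_nonneg G hβ.le B t (monotone_spin v)).trans (hc v)
  refine h1.trans (h2.trans ?_)
  have hcoef : ∀ u, 0 ≤ (if u ∉ ball G (k + 2) v then b u / 2 else 0) +
      if u ∈ ball G (k + 3) v then ε else 0 := by
    intro u
    have := hb0 u
    split_ifs <;> positivity
  refine (Finset.sum_le_sum fun u _ => mul_le_mul_of_nonneg_left (hc u) (hcoef u)).trans ?_
  rw [← Finset.sum_mul, Finset.sum_add_distrib, ← Finset.sum_filter, ← Finset.sum_filter,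
    ← Finset.sum_div, Finset.sum_const, nsmul_eq_mul]
  have hball : ((Finset.univ.filter fun u => u ∈ ball G (k + 3) v).card : ℝ) ≤
      ((q + 1 + 1 : ℕ) : ℝ) ^ (k + 3) := by
    rw [Finset.filter_mem_eq_inter, Finset.univ_inter]
    exact_mod_cast card_ball_le G hdeg (k + 3) v
  have h3 := mul_le_mul_of_nonneg_right hball hε0
  have h4 : (∑ u with u ∉ ball G (k + 2) v, b u) / 2 +
      (Finset.univ.filter fun u => u ∈ ball G (k + 3) v).card * ε ≤ 1 / 2 := by linarith
  exact (mul_le_mul_of_nonneg_right h4 hc0).trans (le_of_eq (by ring))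

/-! ### From the magnetization gap to mixing and relaxation times -/

section Convergence

variable {V : Type*} [Fintype V] [DecidableEq V] (G : SimpleGraph V) [DecidableRel G.Adj] {β : ℝ}

/-- With L the evolved linear function, L + P^t f is increasing, which bounds the difference by the
gap of f plus two gaps of L; the gap of f is itself at most that of L. -/
theorem dynamicsOp_pow_sub_le (hβ : 0 ≤ β) {r : ℕ} (B : Fin r → Finset V) (t : ℕ)
    {f : (V → Bool) → ℝ} {c : V → ℝ}
    (hf : ∀ σ u, |f (Function.update σ u true) - f (Function.update σ u false)| ≤ 2 * c u)
    (σ τ : V → Bool) :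
    (dynamicsOp G β B ^ t) f σ - (dynamicsOp G β B ^ t) f τ ≤
      3 * ∑ u, c u * extremalGap G β B t fun σ => spin (σ u) := by
  have hc : ∀ u, 0 ≤ c u := fun u => by linarith [(abs_nonneg _).trans (hf σ u)]
  have hU := (isMonotoneReversible_dynamicsOp G hβ B).pow t
  have h1 := extremalGap_le_sum G hβ B t hf
  rw [← extremalGap_sum_smul] at h1 ⊢
  have hL := hU.monotone _ (monotone_sum_smul_spin hc)
  have hLf := hU.monotone _ (monotone_sum_smul_spin_add hf)
  rw [map_add] at hLf
  set L := (dynamicsOp G β B ^ t) (∑ u, c u • fun σ : V → Bool => spin (σ u))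
  have h2 := hL (le_top : τ ≤ ⊤)
  have h3 := hL (bot_le : ⊥ ≤ τ)
  have h4 := hLf (le_top : σ ≤ ⊤)
  have h5 := hLf (bot_le : ⊥ ≤ τ)
  have h6 := hL (bot_le : ⊥ ≤ σ)
  simp only [Pi.add_apply] at h4 h5
  simp only [extremalGap] at h1 ⊢
  change _ ≤ 3 * (L ⊤ - L ⊥)
  change _ ≤ L ⊤ - L ⊥ at h1
  linarith

theorem extremalGap_spin_le {r N : ℕ} (B : Fin r → Finset V)
    (hN : ∀ (t : ℕ) (c : ℝ), (∀ u, extremalGap G β B t (fun σ => spin (σ u)) ≤ c) →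
      ∀ v, extremalGap G β B (t + r * N) (fun σ => spin (σ v)) ≤ c / 2) (j : ℕ) (v : V) :
    extremalGap G β B (r * N * j) (fun σ => spin (σ v)) ≤ 2 / 2 ^ j := by
  induction j generalizing v with
  | zero =>
    simp only [mul_zero, extremalGap, pow_zero]
    simp [spin]
    norm_num
  | succ j ih =>
    have := hN _ _ ih v
    rw [mul_add, mul_one, pow_succ, ← div_div]
    exact this

theorem dynamicsOp_pow_sub_le_div_two_pow (hβ : 0 ≤ β) {r N : ℕ} (B : Fin r → Finset V)
    (hN : ∀ (t : ℕ) (c : ℝ), (∀ u, extremalGap G β B t (fun σ => spin (σ u)) ≤ c) →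
      ∀ v, extremalGap G β B (t + r * N) (fun σ => spin (σ v)) ≤ c / 2) (j : ℕ)
    {f : (V → Bool) → ℝ} {c : ℝ} (hf : ∀ σ, |f σ| ≤ c) (σ τ : V → Bool) :
    (dynamicsOp G β B ^ (r * N * j)) f σ - (dynamicsOp G β B ^ (r * N * j)) f τ ≤
      6 * c * Fintype.card V / 2 ^ j := by
  have hc : 0 ≤ c := (abs_nonneg _).trans (hf σ)
  refine (dynamicsOp_pow_sub_le G hβ B _ (f := f) (c := fun _ => c) (fun σ u => ?_) σ τ).trans ?_
  · refine (abs_sub _ _).trans ?_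
    linarith [hf (Function.update σ u true), hf (Function.update σ u false)]
  · have : ∑ u, c * extremalGap G β B (r * N * j) (fun σ => spin (σ u)) ≤
        ∑ _u : V, c * (2 / 2 ^ j) :=
      Finset.sum_le_sum fun u _ =>
        mul_le_mul_of_nonneg_left (extremalGap_spin_le G B hN j u) hc
    rw [Finset.sum_const, nsmul_eq_mul, Finset.card_univ] at this
    refine (mul_le_mul_of_nonneg_left this (by norm_num)).trans (le_of_eq ?_)
    ring

theorem dynamicsOp_pow_apply {r : ℕ} (B : Fin r → Finset V) (t : ℕ) (f : (V → Bool) → ℝ) :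
    (dynamicsOp G β B ^ t) f = (blockDynamics G β B ^ t).mulVec f := by
  induction t with
  | zero => simp
  | succ t ih =>
    rw [pow_succ', pow_succ', Module.End.mul_apply, ih, dynamicsOp, Matrix.mulVecLin_apply,
      Matrix.mulVec_mulVec]

theorem sum_gibbs : ∑ σ, gibbs G β σ = 1 := by
  simp only [gibbs, ← Finset.sum_div]
  exact div_self (sum_isingWeight_pos G β).ne'

theorem sum_gibbs_mul_dynamicsOp_pow (hβ : 0 ≤ β) {r : ℕ} (hr : 0 < r) (B : Fin r → Finset V)
    (t : ℕ) (f : (V → Bool) → ℝ) :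
    ∑ σ, gibbs G β σ * (dynamicsOp G β B ^ t) f σ = ∑ σ, gibbs G β σ * f σ := by
  have h1 : ∀ f : (V → Bool) → ℝ, ∑ σ, gibbs G β σ * f σ =
      pairing G β f 1 / ∑ η, isingWeight G β η := by
    intro f
    rw [pairing, Finset.sum_div]
    refine Finset.sum_congr rfl fun σ _ => ?_
    rw [gibbs, Pi.one_apply]
    ring
  have h2 : (dynamicsOp G β B ^ t) 1 = 1 := by
    induction t with
    | zero => rfl
    | succ t ih => rw [pow_succ, Module.End.mul_apply, dynamicsOp_one G β hr, ih]
  rw [h1, h1, ((isMonotoneReversible_dynamicsOp G hβ B).pow t).symm, h2]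

theorem tvDist_le (hβ : 0 ≤ β) {r N : ℕ} (hr : 0 < r) (B : Fin r → Finset V)
    (hN : ∀ (t : ℕ) (c : ℝ), (∀ u, extremalGap G β B t (fun σ => spin (σ u)) ≤ c) →
      ∀ v, extremalGap G β B (t + r * N) (fun σ => spin (σ v)) ≤ c / 2) (j : ℕ)
    (σ : V → Bool) :
    tvDist ((blockDynamics G β B ^ (r * N * j)) σ) (gibbs G β) ≤
      3 * Fintype.card V / 2 ^ j := by
  set p := (blockDynamics G β B ^ (r * N * j)) σ with hp
  set s : (V → Bool) → ℝ := fun τ => if 0 ≤ p τ - gibbs G β τ then 1 else -1 with hs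
  have hs1 : ∀ τ, |s τ| ≤ 1 := by
    intro τ
    simp only [hs]
    split_ifs <;> simp
  have habs : ∀ τ, |p τ - gibbs G β τ| = p τ * s τ - gibbs G β τ * s τ := by
    intro τ
    simp only [hs]
    split_ifs with h
    · rw [abs_of_nonneg h]; ring
    · rw [abs_of_neg (not_le.1 h)]; ring
  have h1 : ∑ τ, p τ * s τ = (dynamicsOp G β B ^ (r * N * j)) s σ := by
    rw [dynamicsOp_pow_apply]
    rfl
  -- Stationarity writes the distance as a Gibbs average of oscillations of the evolved sign
  -- function.
  have h2 : ∑ τ, |p τ - gibbs G β τ| = ∑ τ, gibbs G β τ *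
      ((dynamicsOp G β B ^ (r * N * j)) s σ - (dynamicsOp G β B ^ (r * N * j)) s τ) := by
    simp only [habs, Finset.sum_sub_distrib, mul_sub]
    rw [h1, ← Finset.sum_mul, sum_gibbs, one_mul, sum_gibbs_mul_dynamicsOp_pow G hβ hr]
  have h3 : ∑ τ, |p τ - gibbs G β τ| ≤ 6 * 1 * Fintype.card V / 2 ^ j := by
    rw [h2]
    have : ∑ τ, gibbs G β τ * (6 * 1 * Fintype.card V / 2 ^ j) =
        6 * 1 * Fintype.card V / 2 ^ j := by
      rw [← Finset.sum_mul, sum_gibbs, one_mul]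
    rw [← this]
    refine Finset.sum_le_sum fun τ _ => mul_le_mul_of_nonneg_left
      (dynamicsOp_pow_sub_le_div_two_pow G hβ B hN j hs1 σ τ) ?_
    exact div_nonneg (isingWeight_pos G β τ).le (sum_isingWeight_pos G β).le
  rw [tvDist]
  refine (mul_le_mul_of_nonneg_left h3 (by norm_num)).trans (le_of_eq ?_)
  ring

/-- On an eigenfunction the oscillation bound makes the powers of 2 |λ|^(rN) bounded in j, so this
number is at most 1 whatever the prefactor n. -/
theorem abs_le_of_mem_nontrivialEigenvalues (hβ : 0 ≤ β) {r N : ℕ} (hr : 0 < r) (hN0 : 0 < N)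
    (B : Fin r → Finset V)
    (hN : ∀ (t : ℕ) (c : ℝ), (∀ u, extremalGap G β B t (fun σ => spin (σ u)) ≤ c) →
      ∀ v, extremalGap G β B (t + r * N) (fun σ => spin (σ v)) ≤ c / 2) {lam : ℝ}
    (hlam : lam ∈ nontrivialEigenvalues (blockDynamics G β B)) :
    |lam| ≤ 1 - 1 / (2 * (r * N)) := by
  obtain ⟨f, ⟨σ, τ, hne⟩, hf⟩ := hlam
  have hpow : ∀ t, (dynamicsOp G β B ^ t) f = lam ^ t • f := by
    intro t
    induction t with
    | zero => simp
    | succ t ih =>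
      have : dynamicsOp G β B f = lam • f := hf
      rw [pow_succ, Module.End.mul_apply, this, map_smul, ih, smul_smul, pow_succ']
  set c := ∑ η, |f η|
  have hc : ∀ η, |f η| ≤ c := fun η =>
    Finset.single_le_sum (f := fun η => |f η|) (fun _ _ => abs_nonneg _) (Finset.mem_univ η)
  have hbound : ∀ j : ℕ, (2 * |lam| ^ (r * N)) ^ j ≤ 6 * c * Fintype.card V / |f σ - f τ| := by
    intro j
    have h1 := dynamicsOp_pow_sub_le_div_two_pow G hβ B hN j hc σ τ
    have h2 := dynamicsOp_pow_sub_le_div_two_pow G hβ B hN j hc τ σ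
    rw [hpow] at h1 h2
    simp only [Pi.smul_apply, smul_eq_mul] at h1 h2
    have h3 : |lam| ^ (r * N * j) * |f σ - f τ| ≤ 6 * c * Fintype.card V / 2 ^ j := by
      rw [← abs_pow, ← abs_mul, abs_le]
      constructor <;> linarith
    rw [le_div_iff₀ (by positivity)] at h3
    rw [le_div_iff₀ (abs_pos.2 (sub_ne_zero.2 hne)), mul_pow, ← pow_mul]
    linarith
  have hhalf : 2 * |lam| ^ (r * N) ≤ 1 := by
    by_contra h
    obtain ⟨j, hj⟩ := pow_unbounded_of_one_lt (6 * c * Fintype.card V / |f σ - f τ|)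
      (not_le.1 h)
    exact absurd (hbound j) (not_le.2 hj)
  have hM : (1 : ℝ) ≤ r * N := by
    have : 1 ≤ r * N := Nat.mul_pos hr hN0
    exact_mod_cast this
  have hx : 1 / (2 * ((r : ℝ) * N)) ≤ 1 / 2 := by
    rw [div_le_div_iff₀ (by positivity) two_pos]
    linarith
  by_contra h
  have hlt := not_le.1 h
  -- Bernoulli: (1 - 1/(2rN))^(rN) ≥ 1/2.
  have h1 := one_add_mul_le_pow (a := -(1 / (2 * ((r : ℝ) * N)))) (by linarith) (r * N)
  have h2 : (1 + -(1 / (2 * ((r : ℝ) * N)))) ^ (r * N) < |lam| ^ (r * N) :=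
    pow_lt_pow_left₀ (by linarith) (by linarith) (Nat.mul_pos hr hN0).ne'
  have h3 : 1 + ((r * N : ℕ) : ℝ) * -(1 / (2 * ((r : ℝ) * N))) = 1 / 2 := by
    have : (r : ℝ) * N ≠ 0 := by positivity
    push_cast
    field_simp
    norm_num
  linarith

theorem relaxationTime_le {Ω : Type*} [Fintype Ω] {P : Matrix Ω Ω ℝ} {M : ℝ} (hM : 1 ≤ M)
    (h : ∀ lam ∈ nontrivialEigenvalues P, |lam| ≤ 1 - 1 / M) :
    relaxationTime P ≤ ENNReal.ofReal M := by
  have hM0 : 0 < M := by linarith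
  have h1 : lambdaStar P ≤ ENNReal.ofReal (1 - 1 / M) :=
    iSup₂_le fun lam hlam => ENNReal.ofReal_le_ofReal (h lam hlam)
  have h2 : ENNReal.ofReal (1 / M) ≤ 1 - lambdaStar P := by
    refine le_trans ?_ (tsub_le_tsub_left h1 1)
    have hle : 1 / M ≤ 1 := by rw [div_le_one hM0]; exact hM
    rw [← ENNReal.ofReal_one, ← ENNReal.ofReal_sub _ (by linarith)]
    exact ENNReal.ofReal_le_ofReal (by linarith)
  rw [relaxationTime]
  refine (ENNReal.inv_le_inv.2 h2).trans (le_of_eq ?_)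
  rw [← ENNReal.ofReal_inv_of_pos (by positivity), one_div, inv_inv]

theorem mixingTime_le {Ω : Type*} [Fintype Ω] [DecidableEq Ω] {P : Matrix Ω Ω ℝ} {π : Ω → ℝ}
    {ε : ℝ} {t : ℕ} (h : ∀ x, tvDist ((P ^ t) x) π ≤ ε) : mixingTime P π ε ≤ t :=
  iSup_le fun x => iInf₂_le t (h x)

theorem exists_halving_steps {n : ℕ} (hn : 2 ≤ n) :
    ∃ j : ℕ, (3 * n / 2 ^ j : ℝ) ≤ 1 / 4 ∧ (j : ℝ) ≤ 12 * Real.log n := by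
  have hn' : (2 : ℝ) ≤ n := by exact_mod_cast hn
  have hlog2 := Real.log_two_gt_d9
  have hlogn : Real.log 2 ≤ Real.log n := Real.log_le_log two_pos hn'
  -- The exponent 5 suffices because n ^ 5 ≥ 16 n ≥ 12 n for n ≥ 2.
  refine ⟨⌈5 * Real.log n / Real.log 2⌉₊, ?_, ?_⟩
  · set j := ⌈5 * Real.log n / Real.log 2⌉₊
    have h1 : 5 * Real.log n / Real.log 2 ≤ j := Nat.le_ceil _
    rw [div_le_iff₀ (by linarith)] at h1
    have h2 : (n : ℝ) ^ 5 ≤ 2 ^ j := by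
      rw [← Real.log_le_log_iff (by positivity) (by positivity), Real.log_pow, Real.log_pow]
      exact_mod_cast h1
    have h3 : (16 : ℝ) * n ≤ n ^ 5 := by
      have : (2 : ℝ) ^ 4 ≤ n ^ 4 := pow_le_pow_left₀ two_pos.le hn' 4
      nlinarith
    rw [div_le_iff₀ (by positivity)]
    linarith
  · have h1 := (Nat.ceil_lt_add_one (a := 5 * Real.log n / Real.log 2)
      (div_nonneg (by linarith) (by linarith))).le
    have h2 : 1 ≤ Real.log n / Real.log 2 := by
      rw [le_div_iff₀ (by linarith)]
      linarith
    have h3 : Real.log n / Real.log 2 ≤ 2 * Real.log n := by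
      rw [div_le_iff₀ (by linarith)]
      nlinarith
    rw [mul_div_assoc] at h1 ⊢
    linarith

end Convergence

/-! ### The threshold condition and the conclusion -/

theorem natPred_mul_tanh_lt_one {d : ℕ} {β : ℝ} (hβ : 0 < β) (h : (β : EReal) < betaC d) :
    ((d - 1 : ℕ) : ℝ) * Real.tanh β < 1 := by
  have ht := tanh_nonneg hβ.le
  have ht1 := Real.tanh_lt_one β
  by_cases hd : 3 ≤ d
  · obtain ⟨b, hb, hbt⟩ := betaC_spec hd
    rw [hb, EReal.coe_lt_coe_iff] at h
    have hlt : Real.tanh β < Real.tanh b := by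
      rw [Real.tanh_eq_sinh_div_cosh, Real.tanh_eq_sinh_div_cosh,
        div_lt_div_iff₀ (Real.cosh_pos _) (Real.cosh_pos _)]
      have := Real.sinh_pos_iff.2 (sub_pos.2 h)
      rw [Real.sinh_sub] at this
      linarith
    have hd3 : (3 : ℝ) ≤ d := by exact_mod_cast hd
    rw [Nat.cast_sub (by omega), Nat.cast_one]
    exact (mul_lt_mul_of_pos_left hlt (by linarith)).trans_eq hbt
  · have : ((d - 1 : ℕ) : ℝ) ≤ 1 := by exact_mod_cast (by omega : d - 1 ≤ 1)
    nlinarith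

end

end IsingBlocks

theorem theorem3 (d : ℕ) (β : ℝ) (hβ : 0 < β) (hβc : (β : EReal) < IsingBlocks.betaC d) :
    ∃ C : ℝ, 0 < C ∧
      ∀ (V : Type*) [Fintype V] [DecidableEq V] [Nonempty V]
        (G : SimpleGraph V) [DecidableRel G.Adj], (∀ v, G.degree v ≤ d) →
      ∀ (r : ℕ) (B : Fin r → Finset V), (∀ v, ∃ i, v ∈ B i) →
        (2 ≤ Fintype.card V →
          ((IsingBlocks.mixingTime (IsingBlocks.blockDynamics G β B)
              (IsingBlocks.gibbs G β) (1 / 4) : ℕ∞) : ENNReal) ≤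
            ENNReal.ofReal (C * (r * Real.log (Fintype.card V)))) ∧
        IsingBlocks.relaxationTime (IsingBlocks.blockDynamics G β B) ≤
          ENNReal.ofReal (C * r) := by
  obtain ⟨N, hN0, hN⟩ := IsingBlocks.exists_extremalGap_le_half hβ
    (IsingBlocks.natPred_mul_tanh_lt_one hβ hβc)
  -- 12 comes from the number of halvings, j ≤ 12 log n; the relaxation time needs only 2N.
  refine ⟨12 * N, by positivity, ?_⟩
  intro V _ _ _ G _ hdeg r B hB
  -- The truncated q = d - 1 still satisfies d ≤ q + 1, also for d = 0.
  have hhalf := hN V G (fun v => (hdeg v).trans (by omega)) r B hB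
  have hr : 0 < r := (hB (Classical.arbitrary V)).choose.pos
  refine ⟨fun hn => ?_, ?_⟩
  · obtain ⟨j, hj1, hj2⟩ := IsingBlocks.exists_halving_steps hn
    have h1 := IsingBlocks.mixingTime_le (P := IsingBlocks.blockDynamics G β B)
      (t := r * N * j) fun σ => (IsingBlocks.tvDist_le G hβ.le hr B hhalf j σ).trans hj1
    have h2 : ((r * N * j : ℕ) : ENNReal) ≤
        ENNReal.ofReal (12 * N * (r * Real.log (Fintype.card V))) := by
      rw [← ENNReal.ofReal_natCast]
      refine ENNReal.ofReal_le_ofReal ?_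
      push_cast
      refine (mul_le_mul_of_nonneg_left hj2 (by positivity)).trans (le_of_eq ?_)
      ring
    refine le_trans ?_ h2
    exact_mod_cast ENat.toENNReal_le.2 h1
  · have hM : (1 : ℝ) ≤ r * N := by
      have : 1 ≤ r * N := Nat.mul_pos hr hN0
      exact_mod_cast this
    refine (IsingBlocks.relaxationTime_le (M := 2 * (r * N)) (by linarith) fun lam hlam =>
      IsingBlocks.abs_le_of_mem_nontrivialEigenvalues G hβ.le hr hN0 B hhalf hlam).trans
      (ENNReal.ofReal_le_ofReal ?_)
    linarith
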